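/- Define $\psi:\mathbb R\to\mathbb R$ by $\psi(x)=\log 2$ for $x\ge 1$, $\psi(x)=-\log(1-x+x^2/2)$ for $0\le x\le 1$, and $\psi(x)=-\psi(-x)$ for $x\le 0$. Let $X$ be an integrable random vector in $\mathbb R^d$, let $X_1,\dots,X_n$ be $n$ independent copies of $X$, and let $\kappa>0$ be a constant such that for every $\theta\in\mathbb R^d$ $$\mathbb E\bigl(\langle\theta,X-\mathbb E(X)\rangle^4\bigr)\le\kappa\,\mathbb E\bigl(\langle\theta,X-\mathbb E(X)\rangle^2\bigr)^2<\infty .$$ For $\epsilon>0$ put $$\lambda=\sqrt{\frac{2}{(\kappa+2\sqrt\kappa)\,n}\bigl[\log(\epsilon^{-1})+0.73(d+1)\bigr]},$$ $$\mu=\sqrt{\frac{2(\kappa+2\sqrt\kappa)}{n}\bigl[\log(\epsilon^{-1})+0.73(d+1)\bigr]}+6.81\,(\sqrt\kappa+1)\sqrt{\frac{2(d+1)}{n}},$$ and for $\theta\in\mathbb R^d$ $$\widehat N(\theta)=\inf_{\xi\in\mathbb R}\,\inf\Bigl\{\rho>0:\ \sum_{i=1}^n\psi\Bigl(\lambda\Bigl[\frac{(\langle\theta,X_i\rangle-\xi)^2}{\rho}-1\Bigr]\Bigr)\le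 0\Bigr\}.$$ If $$n>\Bigl[20(\sqrt\kappa+1)\sqrt{d+1}+\Bigl(\frac52+\frac1{2(\kappa+2\sqrt\kappa)}\Bigr)\sqrt{2(\kappa+2\sqrt\kappa)\bigl[\log(\epsilon^{-1})+0.73(d+1)\bigr]}\Bigr]^2,$$ then with probability at least $1-2\epsilon$ (that is, on a measurable event of at least this probability), for all $\theta\in\mathbb R^d$ simultaneously, $$\Bigl|\frac{\mathbb E\bigl(\langle\theta,X-\mathbb E(X)\rangle^2\bigr)}{\widehat N(\theta)}-1\Bigr|\le\frac{\mu}{1-2\mu},$$ with the convention that $0/0=1$ and $z/0=+\infty$ for $z>0$. Moreover there is a numerical constant $C>0$ such that, for all $d,n$, all $\kappa\ge 1$ and all $0<\epsilon\le 1/2$ satisfying the above condition on $n$, $$\frac{\mu}{1-2\mu}\le C\sqrt{\frac{\kappa\,[d+\log(\epsilon^{-1})]}{n}}.$$ -/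

import Mathlib

open MeasureTheory ProbabilityTheory

namespace RobustCov

noncomputable section

/-- The influence function on the half-line `x ≥ 0`. -/
def psiPos (x : ℝ) : ℝ :=
  if 1 ≤ x then Real.log 2 else -Real.log (1 - x + x ^ 2 / 2)

/-- The influence function `ψ`: the odd extension of `psiPos`. -/
def psi (x : ℝ) : ℝ :=
  if 0 ≤ x then psiPos x else -psiPos (-x)

/-- The robust energy of `⟨θ, X⟩ - ξ` computed from the sample `x₁, …, xₙ`:
the infimum of all `ρ > 0` with `∑ᵢ ψ(λ((⟨θ, xᵢ⟩ - ξ)² / ρ - 1)) ≤ 0`.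
For `n ≥ 1` and `λ > 0` the set is non-empty, as it contains all large `ρ`. -/
def robustEnergy {d n : ℕ} (lam : ℝ) (x : Fin n → EuclideanSpace ℝ (Fin d))
    (θ : EuclideanSpace ℝ (Fin d)) (ξ : ℝ) : ℝ :=
  sInf {ρ : ℝ | 0 < ρ ∧ ∑ i, psi (lam * ((inner ℝ θ (x i) - ξ) ^ 2 / ρ - 1)) ≤ 0}

/-- The robust estimate of the variance in the direction `θ`. -/
def covEstimate {d n : ℕ} (lam : ℝ) (x : Fin n → EuclideanSpace ℝ (Fin d))
    (θ : EuclideanSpace ℝ (Fin d)) : ℝ :=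
  ⨅ ξ : ℝ, robustEnergy lam x θ ξ

/-- The scale parameter `λ`. -/
def scale (d n : ℕ) (κ ε : ℝ) : ℝ :=
  √(2 / ((κ + 2 * √κ) * n) * (Real.log ε⁻¹ + 0.73 * (d + 1)))

/-- The deviation parameter `μ`. -/
def dev (d n : ℕ) (κ ε : ℝ) : ℝ :=
  √(2 * (κ + 2 * √κ) / n * (Real.log ε⁻¹ + 0.73 * (d + 1)))
    + 6.81 * (√κ + 1) * √(2 * (d + 1) / n)

/-- The value that the sample size has to exceed. -/
def threshold (d : ℕ) (κ ε : ℝ) : ℝ :=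
  (20 * (√κ + 1) * √(d + 1)
    + (5 / 2 + 1 / (2 * (κ + 2 * √κ)))
      * √(2 * (κ + 2 * √κ) * (Real.log ε⁻¹ + 0.73 * (d + 1)))) ^ 2

/-- The ratio `a / b` for `a, b ≥ 0`, with `0 / 0 = 1` and `a / 0 = +∞` for `a > 0`. -/
def ratio (a b : ℝ) : EReal :=
  if b = 0 then (if a = 0 then 1 else ⊤) else ((a / b : ℝ) : EReal)

/-- The variance `E(⟨θ, X - E X⟩²) = θᵀ Σ θ` in the direction `θ`. -/
def dirVar {d : ℕ} {Ω : Type*} [MeasurableSpace Ω] (P : Measure Ω)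
    (X : Ω → EuclideanSpace ℝ (Fin d)) (θ : EuclideanSpace ℝ (Fin d)) : ℝ :=
  ∫ ω, (inner ℝ θ (X ω - ∫ ω', X ω' ∂P)) ^ 2 ∂P

/-- In every direction the fourth centered moment is finite and at most `κ` times the square
of the second centered moment. -/
def KurtosisLE {d : ℕ} {Ω : Type*} [MeasurableSpace Ω] (P : Measure Ω)
    (X : Ω → EuclideanSpace ℝ (Fin d)) (κ : ℝ) : Prop :=
  ∀ θ : EuclideanSpace ℝ (Fin d),
    Integrable (fun ω => (inner ℝ θ (X ω - ∫ ω', X ω' ∂P)) ^ 4) P ∧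
    ∫ ω, (inner ℝ θ (X ω - ∫ ω', X ω' ∂P)) ^ 4 ∂P ≤ κ * dirVar P X θ ^ 2

end

end RobustCov

/-! ### The influence function: smoothness and exponential bounds. -/

namespace RobustCov

/-! For a direction θ, a centre ξ and a level ρ, the criterion defining the estimate is almost
surely a sum of terms ψ(⟨v, Zᵢ⟩² - λ). Here Zᵢ is a whitened observation in dimension d + 1 whose
extra coordinate is the constant 1, which absorbs ξ (`exists_whitening`). It is therefore enough to
bound these sums for all relevant v at once.

The uniform bound is PAC-Bayesian. Replace v by a Gaussian w with mean v and covariance b² I, so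
that ⟨w, z⟩² - b²‖z‖² has mean ⟨v, z⟩². Since ψ' is 2-Lipschitz, a reverse Jensen inequality
(`psi_integral_le`) bounds ψ of the mean by the mean of ψ plus a variance truncated at 2 log 2. That
truncated variance is in turn dominated using the Gaussian mean of a logarithm
(`psi_le_integral_gaussianReal`). The exponential of the resulting exponent is at most 1 plus a
polynomial of degree four in z, so fourth moments suffice to control its expectation. Markov's
inequality is applied to a single Gaussian mixture of exponential moments. Cameron–Martin and Jensen
then give a bound at every v, at the entropy price ‖v‖² / (2b²)
(`integral_add_le_of_lintegral_exp_le`, `exists_event_sum_psi_le`).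

The bound is used for both signs σ = ±1, ψ being odd. With b² = 1/(8nu) and u² = (√κ + 1)²(d + 1)/n
it depends on v only through ‖v‖². For δ = μ/(1 - 2μ), the sum of ψ is nonpositive when ‖v‖² = λ(1 -
δ) and positive when ‖v‖² = λ(1 + δ) (`deviation_upper`, `deviation_lower`). Writing V for the true
variance, the estimate then lies above V/(1 + δ) and, if δ < 1, below V/(1 - δ). -/

lemma psi_of_nonneg {x : ℝ} (hx : 0 ≤ x) :
    psi x = Real.log 2 - Real.log (1 + max (1 - x) 0 ^ 2) := by
  rw [psi, if_pos hx, psiPos]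
  split_ifs with h
  · rw [max_eq_right (by linarith)]; simp
  · rw [max_eq_left (by linarith),
      show 1 - x + x ^ 2 / 2 = (1 + (1 - x) ^ 2) / 2 by ring,
      Real.log_div (by positivity) (by norm_num)]
    ring

lemma psi_zero : psi 0 = 0 := by
  rw [psi_of_nonneg le_rfl]; norm_num

lemma psi_neg (x : ℝ) : psi (-x) = -psi x := by
  rcases lt_trichotomy x 0 with h | rfl | h
  · conv_rhs => rw [psi, if_neg (not_le.2 h)]
    rw [psi, if_pos (by linarith), neg_neg]
  · simp [psi_zero]
  · rw [psi, if_neg (by linarith), neg_neg]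
    conv_rhs => rw [psi, if_pos h.le]

lemma psi_of_nonpos {x : ℝ} (hx : x ≤ 0) :
    psi x = Real.log (1 + max (1 + x) 0 ^ 2) - Real.log 2 := by
  have := psi_neg (-x)
  rw [neg_neg] at this
  rw [this, psi_of_nonneg (by linarith)]
  ring_nf

lemma hasDerivAt_max_zero_sq (x : ℝ) :
    HasDerivAt (fun y : ℝ => max y 0 ^ 2) (2 * max x 0) x := by
  rcases lt_trichotomy x 0 with h | rfl | h
  · rw [max_eq_right h.le, mul_zero]
    refine (hasDerivAt_const x (0 : ℝ)).congr_of_eventuallyEq ?_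
    filter_upwards [Iio_mem_nhds h] with y hy
    rw [max_eq_right (le_of_lt hy)]; norm_num
  · rw [max_self, mul_zero, hasDerivAt_iff_isLittleO]
    have h1 : (fun y : ℝ => max y 0 ^ 2 - max (0 : ℝ) 0 ^ 2 - (y - 0) • (0 : ℝ))
        =O[nhds 0] fun y : ℝ => (y - 0) ^ 2 := by
      refine Asymptotics.isBigO_of_le _ fun y => ?_
      simp only [max_self, sub_zero, smul_zero, norm_pow, Real.norm_eq_abs, ne_eq,
        OfNat.ofNat_ne_zero, not_false_eq_true, zero_pow]
      refine pow_le_pow_left₀ (abs_nonneg _) ?_ 2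
      rcases le_total y 0 with h | h
      · rw [max_eq_right h]; simp
      · rw [max_eq_left h]
    refine h1.trans_isLittleO ?_
    simpa using Asymptotics.isLittleO_pow_id (𝕜 := ℝ) (n := 2) (by norm_num)
  · rw [max_eq_left h.le]
    refine ((hasDerivAt_pow 2 x).congr_of_eventuallyEq ?_).congr_deriv (by norm_num)
    filter_upwards [Ioi_mem_nhds h] with y hy
    rw [max_eq_left (le_of_lt hy)]

/-- The derivative of `psi`, see `hasDerivAt_psi`. -/
noncomputable def psiDeriv (x : ℝ) : ℝ := 2 * max (1 - |x|) 0 / (1 + max (1 - |x|) 0 ^ 2)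

lemma hasDerivAt_log_max_sq (x : ℝ) :
    HasDerivAt (fun y : ℝ => Real.log (1 + max y 0 ^ 2)) (2 * max x 0 / (1 + max x 0 ^ 2)) x :=
  ((hasDerivAt_max_zero_sq x).const_add 1).log (by positivity)

lemma hasDerivAt_psi (x : ℝ) : HasDerivAt psi (psiDeriv x) x := by
  have hpos : ∀ x : ℝ, 0 ≤ x →
      HasDerivWithinAt psi (psiDeriv x) (Set.Ici 0) x := by
    intro x hx
    have h1 : HasDerivAt (fun y => Real.log 2 - Real.log (1 + max (1 - y) 0 ^ 2))
        (psiDeriv x) x := by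
      have := ((hasDerivAt_log_max_sq (1 - x)).comp x
        ((hasDerivAt_id x).const_sub 1)).const_sub (Real.log 2)
      refine this.congr_deriv ?_
      rw [psiDeriv, abs_of_nonneg hx]; ring
    exact h1.hasDerivWithinAt.congr (fun y hy => psi_of_nonneg hy) (psi_of_nonneg hx)
  have hneg : ∀ x : ℝ, x ≤ 0 →
      HasDerivWithinAt psi (psiDeriv x) (Set.Iic 0) x := by
    intro x hx
    have h1 : HasDerivAt (fun y => Real.log (1 + max (1 + y) 0 ^ 2) - Real.log 2)
        (psiDeriv x) x := by
      have := ((hasDerivAt_log_max_sq (1 + x)).comp x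
        ((hasDerivAt_id x).const_add 1)).sub_const (Real.log 2)
      refine this.congr_deriv ?_
      rw [psiDeriv, abs_of_nonpos hx, sub_neg_eq_add]; ring
    exact h1.hasDerivWithinAt.congr (fun y hy => psi_of_nonpos hy) (psi_of_nonpos hx)
  rcases lt_trichotomy x 0 with h | rfl | h
  · exact (hneg x h.le).hasDerivAt (Iic_mem_nhds h)
  · have := (hneg 0 le_rfl).union (hpos 0 le_rfl)
    rwa [Set.Iic_union_Ici, hasDerivWithinAt_univ] at this
  · exact (hpos x h.le).hasDerivAt (Ici_mem_nhds h)

lemma psiDeriv_nonneg (x : ℝ) : 0 ≤ psiDeriv x := by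
  unfold psiDeriv; positivity

lemma psi_monotone : Monotone psi :=
  monotone_of_deriv_nonneg (fun x => (hasDerivAt_psi x).differentiableAt)
    fun x => by rw [(hasDerivAt_psi x).deriv]; exact psiDeriv_nonneg x

lemma continuous_psi : Continuous psi :=
  continuous_iff_continuousAt.2 fun x => (hasDerivAt_psi x).continuousAt

lemma psi_le_log_two (x : ℝ) : psi x ≤ Real.log 2 := by
  refine (psi_monotone (le_max_left x 0)).trans ?_
  rw [psi_of_nonneg (le_max_right x 0)]
  have := Real.log_nonneg (x := 1 + max (1 - max x 0) 0 ^ 2) (by nlinarith [sq_nonneg (max (1 - max x 0) 0)])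
  linarith

lemma abs_psi_le (x : ℝ) : |psi x| ≤ Real.log 2 := by
  rw [abs_le]
  have := psi_le_log_two (-x)
  rw [psi_neg] at this
  exact ⟨by linarith, psi_le_log_two x⟩

/-- On [0, 1] the reason is (1 + x + x²/2)(1 - x + x²/2) = 1 + x⁴/4 ≥ 1; on [-1, 0] there is
equality. -/
lemma exp_psi_le (x : ℝ) : Real.exp (psi x) ≤ 1 + x + x ^ 2 / 2 := by
  rcases le_total 0 x with h | h
  · rw [psi_of_nonneg h, Real.exp_sub, Real.exp_log (by norm_num), Real.exp_log (by positivity),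
      div_le_iff₀ (by positivity)]
    rcases le_total x 1 with h1 | h1
    · rw [max_eq_left (by linarith)]
      nlinarith [sq_nonneg (x ^ 2)]
    · rw [max_eq_right (by linarith)]
      nlinarith
  · rw [psi_of_nonpos h, Real.exp_sub, Real.exp_log (by positivity), Real.exp_log (by norm_num),
      div_le_iff₀ (by norm_num)]
    rcases le_total (-1) x with h1 | h1
    · rw [max_eq_left (by linarith)]
      nlinarith
    · rw [max_eq_right (by linarith)]
      nlinarith [sq_nonneg (1 + x)]

lemma exp_psi_le_two (x : ℝ) : Real.exp (psi x) ≤ 2 := by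
  rw [← Real.le_log_iff_exp_le (by norm_num)]
  exact psi_le_log_two x

lemma two_mul_div_lipschitz {u w : ℝ} (hu : 0 ≤ u) (huw : u ≤ w) :
    |2 * w / (1 + w ^ 2) - 2 * u / (1 + u ^ 2)| ≤ 2 * (w - u) := by
  rw [div_sub_div _ _ (by positivity) (by positivity), abs_div,
    abs_of_pos (show 0 < (1 + w ^ 2) * (1 + u ^ 2) by positivity), div_le_iff₀ (by positivity),
    show 2 * w * (1 + u ^ 2) - (1 + w ^ 2) * (2 * u) = 2 * (w - u) * (1 - u * w) by ring,
    abs_mul, abs_of_nonneg (by linarith : 0 ≤ 2 * (w - u))]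
  refine mul_le_mul_of_nonneg_left ?_ (by linarith)
  have : 0 ≤ u * w := mul_nonneg hu (hu.trans huw)
  rw [abs_le]
  constructor <;> nlinarith [sq_nonneg (u - w), sq_nonneg (u * w), sq_nonneg (u + w)]

lemma psiDeriv_lipschitz (x y : ℝ) : |psiDeriv x - psiDeriv y| ≤ 2 * |x - y| := by
  have key : ∀ u w : ℝ, 0 ≤ u → 0 ≤ w →
      |2 * w / (1 + w ^ 2) - 2 * u / (1 + u ^ 2)| ≤ 2 * |w - u| := by
    intro u w hu hw
    rcases le_total u w with h | h
    · rw [abs_of_nonneg (by linarith : 0 ≤ w - u)]; exact two_mul_div_lipschitz hu h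
    · rw [abs_sub_comm, abs_sub_comm w u, abs_of_nonneg (by linarith : 0 ≤ u - w)]
      exact two_mul_div_lipschitz hw h
  refine (key _ _ (le_max_right _ _) (le_max_right _ _)).trans ?_
  have h1 := abs_max_sub_max_le_abs (1 - |x|) (1 - |y|) 0
  have h2 : |1 - |x| - (1 - |y|)| ≤ |x - y| := by
    rw [show 1 - |x| - (1 - |y|) = |y| - |x| by ring, abs_sub_comm x y]
    exact abs_abs_sub_abs_le_abs_sub y x
  linarith

/-- As `psiDeriv` is 2-Lipschitz, ψ(x) + x² is convex and lies above its tangents. -/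
lemma psi_add_sq_ge (x y : ℝ) : psi x + psiDeriv x * (y - x) - (y - x) ^ 2 ≤ psi y := by
  have hconv : ConvexOn ℝ Set.univ (fun x => psi x + x ^ 2) := by
    have hd : ∀ x, HasDerivAt (fun x => psi x + x ^ 2) (psiDeriv x + 2 * x) x := fun x =>
      ((hasDerivAt_psi x).add (hasDerivAt_pow 2 x)).congr_deriv (by norm_num)
    refine Monotone.convexOn_univ_of_deriv (fun x => (hd x).differentiableAt) ?_
    intro x y hxy
    rw [(hd x).deriv, (hd y).deriv]
    have := (abs_le.1 (psiDeriv_lipschitz x y)).2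
    rw [abs_of_nonpos (by linarith)] at this
    linarith
  have hd : HasDerivAt (fun x => psi x + x ^ 2) (psiDeriv x + 2 * x) x :=
      ((hasDerivAt_psi x).add (hasDerivAt_pow 2 x)).congr_deriv (by norm_num)
  rcases lt_trichotomy x y with h | rfl | h
  · have := hconv.le_slope_of_hasDerivAt (Set.mem_univ x) (Set.mem_univ y) h hd
    rw [slope_def_field, le_div_iff₀ (by linarith)] at this
    nlinarith
  · simp
  · have := hconv.slope_le_of_hasDerivAt (Set.mem_univ y) (Set.mem_univ x) h hd
    rw [slope_def_field, div_le_iff₀ (by linarith)] at this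
    nlinarith

end RobustCov

namespace RobustCov

open scoped ENNReal NNReal

/-! ### Moments of a centred real Gaussian up to order four. -/

section GaussianMoments

variable (v : ℝ≥0)

lemma integrable_pow_gaussianReal (n : ℕ) :
    Integrable (fun x : ℝ => x ^ n) (gaussianReal 0 v) :=
  (memLp_id_gaussianReal (μ := 0) (v := v) n).integrable_norm_pow'.mono'
    (by fun_prop) (by filter_upwards with x; simp)

lemma integral_sq_gaussianReal : ∫ x, x ^ 2 ∂gaussianReal 0 v = v := by
  have h := variance_fun_id_gaussianReal (μ := 0) (v := v)
  rw [variance_of_integral_eq_zero (by fun_prop) (by simp)] at h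
  exact h

lemma integral_pow_three_gaussianReal : ∫ x, x ^ 3 ∂gaussianReal 0 v = 0 := by
  have h : ∫ x, x ^ 3 ∂gaussianReal 0 v = ∫ x, (-x) ^ 3 ∂gaussianReal 0 v := by
    conv_lhs => rw [show gaussianReal 0 v = (gaussianReal 0 v).map (fun x => -x) by
      rw [gaussianReal_map_neg, neg_zero]]
    rw [integral_map (by fun_prop) (by fun_prop)]
  simp_rw [Odd.neg_pow (by decide : Odd 3)] at h
  rw [integral_neg] at h
  linarith

/-- Read off as the fourth derivative at 0 of the moment generating function exp(vt²/2). -/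
lemma integral_pow_four_gaussianReal : ∫ x, x ^ 4 ∂gaussianReal 0 v = 3 * (v : ℝ) ^ 2 := by
  have h := iteratedDeriv_mgf_zero (X := id) (μ := gaussianReal 0 v) (by simp) 4
  rw [mgf_id_gaussianReal] at h
  have e : ∀ t : ℝ, HasDerivAt (fun t : ℝ => Real.exp (v * t ^ 2 / 2))
      (Real.exp (v * t ^ 2 / 2) * (v * t)) t := fun t => by
    refine (((hasDerivAt_pow 2 t).const_mul (v : ℝ)).div_const 2).exp.congr_deriv ?_
    norm_num; ring
  have d0 : (fun t : ℝ => Real.exp (0 * t + v * t ^ 2 / 2))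
    = fun t => Real.exp (v * t ^ 2 / 2) := by simp
  have d1 : deriv (fun t : ℝ => Real.exp (v * t ^ 2 / 2))
      = fun t => Real.exp (v * t ^ 2 / 2) * (v * t) := funext fun t => (e t).deriv
  have d2 : deriv (fun t : ℝ => Real.exp (v * t ^ 2 / 2) * (v * t))
      = fun t => Real.exp (v * t ^ 2 / 2) * (v + v ^ 2 * t ^ 2) := funext fun t => by
    refine (((e t).mul ((hasDerivAt_id t).const_mul (v : ℝ))).congr_deriv ?_).deriv
    simp only [id]; ring
  have d3 : deriv (fun t : ℝ => Real.exp (v * t ^ 2 / 2) * (v + v ^ 2 * t ^ 2))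
      = fun t => Real.exp (v * t ^ 2 / 2) * (3 * v ^ 2 * t + v ^ 3 * t ^ 3) := funext fun t => by
    refine (((e t).mul (((hasDerivAt_pow 2 t).const_mul ((v : ℝ) ^ 2)).const_add
      (v : ℝ))).congr_deriv ?_).deriv
    norm_num; ring
  have d4 : HasDerivAt
      (fun t : ℝ => Real.exp (v * t ^ 2 / 2) * (3 * v ^ 2 * t + v ^ 3 * t ^ 3))
      (3 * (v : ℝ) ^ 2) 0 := by
    refine ((e 0).mul (((hasDerivAt_id (0 : ℝ)).const_mul (3 * (v : ℝ) ^ 2)).add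
      ((hasDerivAt_pow 3 (0 : ℝ)).const_mul ((v : ℝ) ^ 3)))).congr_deriv ?_
    simp
  rw [d0, iteratedDeriv_succ, iteratedDeriv_succ, iteratedDeriv_succ, iteratedDeriv_one, d1, d2,
    d3, d4.deriv] at h
  simpa using h.symm

end GaussianMoments

/-! ### Gaussian shifts and the PAC-Bayesian inequality. -/

section CameronMartin

lemma gaussianReal_withDensity_exp (t : ℝ) :
    (gaussianReal 0 1).withDensity (fun x => ENNReal.ofReal (Real.exp (t * x - t ^ 2 / 2)))
      = gaussianReal t 1 := by
  rw [gaussianReal_of_var_ne_zero _ one_ne_zero, gaussianReal_of_var_ne_zero _ one_ne_zero,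
    ← withDensity_mul _ (measurable_gaussianPDF _ _) (by fun_prop)]
  congr 1
  ext x
  rw [Pi.mul_apply, gaussianPDF, gaussianPDF, ← ENNReal.ofReal_mul (gaussianPDFReal_nonneg _ _ _),
    gaussianPDFReal, gaussianPDFReal, mul_assoc, ← Real.exp_add]
  congr 3
  simp; ring

lemma pi_withDensity {ι : Type*} [Fintype ι] {α : ι → Type*} [∀ i, MeasurableSpace (α i)]
    (μ : ∀ i, Measure (α i)) [∀ i, IsProbabilityMeasure (μ i)] (f : ∀ i, α i → ℝ≥0∞)
    (hf : ∀ i, Measurable (f i)) [∀ i, SigmaFinite ((μ i).withDensity (f i))] :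
    (Measure.pi μ).withDensity (fun x => ∏ i, f i (x i))
      = Measure.pi fun i => (μ i).withDensity (f i) := by
  refine (Measure.pi_eq fun s hs => ?_).symm
  rw [withDensity_apply _ (.univ_pi hs), ← lintegral_indicator (.univ_pi hs)]
  have h : ∀ x, (Set.univ.pi s).indicator (fun x => ∏ i, f i (x i)) x
      = ∏ i, (s i).indicator (f i) (x i) := fun x => by
    classical
    by_cases hx : x ∈ Set.univ.pi s
    · rw [Set.indicator_of_mem hx]
      exact Finset.prod_congr rfl fun i _ => (Set.indicator_of_mem (hx i trivial) _).symm
    · rw [Set.indicator_of_notMem hx]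
      simp only [Set.mem_univ_pi, not_forall] at hx
      obtain ⟨i, hi⟩ := hx
      exact (Finset.prod_eq_zero (Finset.mem_univ i) (Set.indicator_of_notMem hi _)).symm
  simp_rw [h]
  have hm : ∀ i, Measurable ((s i).indicator (f i)) := fun i => (hf i).indicator (hs i)
  have hind := iIndepFun_pi (μ := μ) (X := fun i => (s i).indicator (f i))
    fun i => (hm i).aemeasurable
  rw [lintegral_prod_eq_prod_lintegral_of_indepFun Finset.univ _ hind
    fun i => (hm i).comp (measurable_pi_apply i)]
  refine Finset.prod_congr rfl fun i _ => ?_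
  rw [withDensity_apply _ (hs i), ← lintegral_indicator (hs i)]
  exact (measurePreserving_eval μ i).lintegral_comp (hm i)

variable {ι : Type*} [Fintype ι]

/-- The Cameron–Martin formula for the standard Gaussian measure. -/
lemma stdGaussian_withDensity_exp (t : EuclideanSpace ℝ ι) :
    (stdGaussian (EuclideanSpace ℝ ι)).withDensity
        (fun x => ENNReal.ofReal (Real.exp (inner ℝ t x - ‖t‖ ^ 2 / 2)))
      = (stdGaussian (EuclideanSpace ℝ ι)).map (fun x => x + t) := by
  have h1 : (Measure.pi fun _ : ι => gaussianReal 0 1).withDensity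
      (fun x => ∏ i, ENNReal.ofReal (Real.exp (t i * x i - t i ^ 2 / 2)))
      = (Measure.pi fun _ : ι => gaussianReal 0 1).map (fun x i => x i + t i) := by
    have hs : ∀ i, (gaussianReal 0 1).withDensity
        (fun x => ENNReal.ofReal (Real.exp (t i * x - t i ^ 2 / 2)))
        = (gaussianReal 0 1).map (fun x => x + t i) := fun i => by
      rw [gaussianReal_withDensity_exp, gaussianReal_map_add_const, zero_add]
    have : ∀ i, SigmaFinite ((gaussianReal 0 1).withDensity
        (fun x => ENNReal.ofReal (Real.exp (t i * x - t i ^ 2 / 2)))) := fun i => by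
      rw [gaussianReal_withDensity_exp]; infer_instance
    rw [pi_withDensity (fun _ : ι => gaussianReal 0 1)
      (fun i x => ENNReal.ofReal (Real.exp (t i * x - t i ^ 2 / 2))) (fun i => by fun_prop)]
    simp_rw [hs]
    have : ∀ i, SigmaFinite ((gaussianReal 0 1).map (fun x => x + t i)) := fun i => by
      rw [gaussianReal_map_add_const]; infer_instance
    exact (Measure.pi_map_pi (fun i => by fun_prop)).symm
  rw [← map_pi_eq_stdGaussian]
  ext s hs
  rw [withDensity_apply _ hs, Measure.map_apply (by fun_prop) hs,
    Measure.map_apply (by fun_prop) ((by fun_prop : Measurable fun x => x + t) hs),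
    setLIntegral_map hs (by fun_prop) (by fun_prop)]
  have hs' : MeasurableSet (WithLp.toLp 2 ⁻¹' s : Set (ι → ℝ)) :=
    (by fun_prop : Measurable (WithLp.toLp 2 : (ι → ℝ) → EuclideanSpace ℝ ι)) hs
  have h2 := congrArg (fun m => m (WithLp.toLp 2 ⁻¹' s : Set (ι → ℝ))) h1
  simp only at h2
  rw [withDensity_apply _ hs', Measure.map_apply (by fun_prop) hs'] at h2
  have h3 : (WithLp.toLp 2 : (ι → ℝ) → EuclideanSpace ℝ ι) ⁻¹' ((fun x => x + t) ⁻¹' s)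
      = (fun x i => x i + t i) ⁻¹' (WithLp.toLp 2 ⁻¹' s) := by
    ext x
    simp only [Set.mem_preimage]
    rfl
  rw [h3]
  convert h2 using 2
  · ext x
    rw [← ENNReal.ofReal_prod_of_nonneg fun i _ => by positivity, ← Real.exp_sum,
      Finset.sum_sub_distrib, ← Finset.sum_div, EuclideanSpace.real_norm_sq_eq]
    simp [PiLp.inner_apply, mul_comm]

/-- The Gaussian PAC-Bayesian (Donsker–Varadhan) inequality. -/
lemma integral_add_le_of_lintegral_exp_le {F : EuclideanSpace ℝ ι → ℝ} (hF : Measurable F)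
    {ε : ℝ} (hε : 0 < ε)
    (hexp : ∫⁻ g, ENNReal.ofReal (Real.exp (F g)) ∂stdGaussian (EuclideanSpace ℝ ι)
      ≤ ENNReal.ofReal ε⁻¹)
    (t : EuclideanSpace ℝ ι)
    (hint : Integrable (fun g => F (g + t)) (stdGaussian (EuclideanSpace ℝ ι))) :
    ∫ g, F (g + t) ∂stdGaussian (EuclideanSpace ℝ ι) ≤ ‖t‖ ^ 2 / 2 + Real.log ε⁻¹ := by
  set γ := stdGaussian (EuclideanSpace ℝ ι) with hγ
  have hinner : ∀ u : EuclideanSpace ℝ ι, Integrable (fun g => inner ℝ u g) γ := fun u =>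
    (IsGaussian.integrable_id (μ := γ)).const_inner u
  have hinner0 : ∀ u : EuclideanSpace ℝ ι, ∫ g, inner ℝ u g ∂γ = 0 := fun u => by
    have := integral_inner (𝕜 := ℝ) (IsGaussian.integrable_id (μ := γ)) u
    simp only [id] at this
    rw [this, hγ, integral_id_stdGaussian, inner_zero_right]
  -- `G` is the shifted exponent corrected by the log-density of the shift. The linear term has mean
  -- zero, so the correction costs exactly the relative entropy ‖t‖²/2. The hypothesis on `F` does
  -- not involve t, so the conclusion is uniform in t.
  set G : EuclideanSpace ℝ ι → ℝ := fun g => F (g + t) - inner ℝ t g - ‖t‖ ^ 2 / 2 with hG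
  have hGint : Integrable G γ := (hint.sub (hinner t)).sub (integrable_const _)
  have hGval : ∫ g, G g ∂γ = ∫ g, F (g + t) ∂γ - ‖t‖ ^ 2 / 2 := by
    have h1 : ∫ g, G g ∂γ = ∫ g, (F (g + t) - inner ℝ t g) ∂γ - ∫ _, ‖t‖ ^ 2 / 2 ∂γ :=
      integral_sub (hint.sub (hinner t)) (integrable_const _)
    rw [h1, integral_sub hint (hinner t), hinner0]
    simp
  have hGm : Measurable G := by
    have := hF.comp (measurable_id.add_const t)
    exact (this.sub (by fun_prop)).sub (by fun_prop)
  have hshift : ∫⁻ g, ENNReal.ofReal (Real.exp (F g)) ∂γ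
      = ∫⁻ g, ENNReal.ofReal (Real.exp (G g)) ∂γ := by
    have h1 : ∫⁻ g, ENNReal.ofReal (Real.exp (F g)) ∂γ
        = ∫⁻ g, ENNReal.ofReal (Real.exp (F g - inner ℝ t g + ‖t‖ ^ 2 / 2))
          ∂(γ.map fun x => x + t) := by
      rw [← stdGaussian_withDensity_exp, lintegral_withDensity_eq_lintegral_mul₀ (by fun_prop)
        (by fun_prop)]
      refine lintegral_congr fun g => ?_
      rw [Pi.mul_apply, ← ENNReal.ofReal_mul (by positivity), ← Real.exp_add]
      ring_nf
    rw [h1, lintegral_map (by fun_prop) (by fun_prop)]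
    refine lintegral_congr fun g => ?_
    rw [inner_add_right, real_inner_self_eq_norm_sq, hG]
    ring_nf
  rw [hshift] at hexp
  have hexpint : Integrable (fun g => Real.exp (G g)) γ := by
    refine ⟨by fun_prop, ?_⟩
    rw [hasFiniteIntegral_iff_ofReal (Filter.Eventually.of_forall fun g => (Real.exp_pos _).le)]
    exact hexp.trans_lt ENNReal.ofReal_lt_top
  have hle : ∫ g, Real.exp (G g) ∂γ ≤ ε⁻¹ := by
    rw [integral_eq_lintegral_of_nonneg_ae
      (Filter.Eventually.of_forall fun g => (Real.exp_pos _).le) (by fun_prop)]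
    exact ENNReal.toReal_le_of_le_ofReal (by positivity) hexp
  have hjensen : Real.exp (∫ g, G g ∂γ) ≤ ∫ g, Real.exp (G g) ∂γ :=
    convexOn_exp.map_integral_le Real.continuous_exp.continuousOn isClosed_univ
      (by simp) hGint hexpint
  have := Real.le_log_iff_exp_le (by positivity : 0 < ε⁻¹) |>.2 (hjensen.trans hle)
  linarith

end CameronMartin

/-- One-dimensional marginals of the standard Gaussian measure. -/
lemma stdGaussian_map_inner {ι : Type*} [Fintype ι] (u : EuclideanSpace ℝ ι) :
    (stdGaussian (EuclideanSpace ℝ ι)).map (fun g => inner ℝ u g)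
      = gaussianReal 0 (‖u‖₊ ^ 2) := by
  have h := IsGaussian.map_eq_gaussianReal (μ := stdGaussian (EuclideanSpace ℝ ι)) (innerSL ℝ u)
  rw [integral_strongDual_stdGaussian, variance_dual_stdGaussian, innerSL_apply_norm] at h
  have hv : (‖u‖ ^ 2).toNNReal = ‖u‖₊ ^ 2 := by
    rw [← NNReal.coe_inj]; simp
  rw [← hv]
  exact h

end RobustCov

/-! ### Gaussian smoothing of ψ in one variable. -/

namespace RobustCov

open scoped ENNReal NNReal

/-- The slope of 2s/(1 + s²) is least at s² = 3, where it is -1/4. In the difference quotient, the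
factor to be bounded is (st - 3)² + (s - t)². -/
lemma monotone_two_mul_div_add :
    Monotone fun s : ℝ => 2 * s / (1 + s ^ 2) + s / 4 := by
  intro s t hst
  have h : 2 * t / (1 + t ^ 2) + t / 4 - (2 * s / (1 + s ^ 2) + s / 4)
      = (t - s) * ((1 + s ^ 2) * (1 + t ^ 2) - 8 * (s * t - 1))
        / (4 * ((1 + s ^ 2) * (1 + t ^ 2))) := by
    field_simp
    ring
  have h2 : 0 ≤ (1 + s ^ 2) * (1 + t ^ 2) - 8 * (s * t - 1) := by
    nlinarith [sq_nonneg (s * t - 3), sq_nonneg (s - t)]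
  have h3 := div_nonneg (mul_nonneg (sub_nonneg.2 hst) h2)
    (by positivity : 0 ≤ 4 * ((1 + s ^ 2) * (1 + t ^ 2)))
  simp only
  linarith

/-- The function log(1 + x²) + x²/8 is convex, hence above its tangents. -/
lemma log_one_add_sq_ge (s t : ℝ) :
    Real.log (1 + s ^ 2) + 2 * s / (1 + s ^ 2) * (t - s) - (t - s) ^ 2 / 8
      ≤ Real.log (1 + t ^ 2) := by
  have hd : ∀ x : ℝ, HasDerivAt (fun x => Real.log (1 + x ^ 2) + x ^ 2 / 8)
      (2 * x / (1 + x ^ 2) + x / 4) x := fun x => by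
    refine ((((hasDerivAt_pow 2 x).const_add 1).log (by positivity)).add
      ((hasDerivAt_pow 2 x).div_const 8)).congr_deriv ?_
    norm_num; ring
  have hconv : ConvexOn ℝ Set.univ (fun x : ℝ => Real.log (1 + x ^ 2) + x ^ 2 / 8) := by
    refine Monotone.convexOn_univ_of_deriv (fun x => (hd x).differentiableAt) ?_
    rw [show deriv (fun x : ℝ => Real.log (1 + x ^ 2) + x ^ 2 / 8)
      = fun x => 2 * x / (1 + x ^ 2) + x / 4 from funext fun x => (hd x).deriv]
    exact monotone_two_mul_div_add
  rcases lt_trichotomy s t with h | rfl | h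
  · have := hconv.le_slope_of_hasDerivAt (Set.mem_univ s) (Set.mem_univ t) h (hd s)
    rw [slope_def_field, le_div_iff₀ (by linarith)] at this
    nlinarith
  · simp
  · have := hconv.slope_le_of_hasDerivAt (Set.mem_univ t) (Set.mem_univ s) h (hd s)
    rw [slope_def_field, div_le_iff₀ (by linarith)] at this
    nlinarith

/-- The graph of exp lies under its chord on [0, 2 log 2], whose slope 3/(2 log 2) is below 5/2. -/
lemma exp_le_one_add_mul {p : ℝ} (h0 : 0 ≤ p) (h1 : p ≤ 2 * Real.log 2) :
    Real.exp p ≤ 1 + 5 / 2 * p := by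
  have hl : 0.6 < Real.log 2 := by linarith [Real.log_two_gt_d9]
  set θ := p / (2 * Real.log 2) with hθ
  have hθp : θ * (2 * Real.log 2) = p := div_mul_cancel₀ _ (by linarith)
  have hθ0 : 0 ≤ θ := by positivity
  have hθ1 : θ ≤ 1 := (div_le_one (by linarith)).2 h1
  have h := convexOn_exp.2 (Set.mem_univ 0) (Set.mem_univ (2 * Real.log 2))
    (by linarith : 0 ≤ 1 - θ) hθ0 (by ring)
  have h4 : Real.exp (2 * Real.log 2) = 4 := by
    rw [two_mul, Real.exp_add, Real.exp_log (by norm_num)]; norm_num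
  rw [h4] at h
  simp only [smul_eq_mul, mul_zero, zero_add, Real.exp_zero, mul_one] at h
  rw [hθp] at h
  nlinarith

lemma integral_polynomial_gaussianReal (v : ℝ≥0) (c₀ c₁ c₂ c₃ c₄ : ℝ) :
    Integrable (fun y : ℝ => c₀ + c₁ * y + c₂ * y ^ 2 + c₃ * y ^ 3 + c₄ * y ^ 4)
      (gaussianReal 0 v) ∧
    ∫ y, (c₀ + c₁ * y + c₂ * y ^ 2 + c₃ * y ^ 3 + c₄ * y ^ 4) ∂gaussianReal 0 v
      = c₀ + c₂ * v + 3 * c₄ * (v : ℝ) ^ 2 := by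
  have i0 : Integrable (fun _ : ℝ => c₀) (gaussianReal 0 v) := integrable_const _
  have i1 : Integrable (fun y : ℝ => c₁ * y) (gaussianReal 0 v) := by
    simpa using (integrable_pow_gaussianReal v 1).const_mul c₁
  have i2 := (integrable_pow_gaussianReal v 2).const_mul c₂
  have i3 := (integrable_pow_gaussianReal v 3).const_mul c₃
  have i4 := (integrable_pow_gaussianReal v 4).const_mul c₄
  have i01 : Integrable (fun y : ℝ => c₀ + c₁ * y) (gaussianReal 0 v) := i0.add i1
  have i02 : Integrable (fun y : ℝ => c₀ + c₁ * y + c₂ * y ^ 2) (gaussianReal 0 v) := i01.add i2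
  have i03 : Integrable (fun y : ℝ => c₀ + c₁ * y + c₂ * y ^ 2 + c₃ * y ^ 3)
    (gaussianReal 0 v) := i02.add i3
  refine ⟨i03.add i4, ?_⟩
  rw [integral_add i03 i4, integral_add i02 i3, integral_add i01 i2, integral_add i0 i1,
    integral_const_mul c₁ fun y => y, integral_id_gaussianReal]
  simp only [integral_const_mul, integral_const,
    integral_sq_gaussianReal, integral_pow_three_gaussianReal, integral_pow_four_gaussianReal]
  simp; ring

lemma integrable_of_bounded {α : Type*} [MeasurableSpace α] {μ : Measure α} [IsFiniteMeasure μ]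
    {f : α → ℝ} (hf : Measurable f) (C : ℝ) (h : ∀ x, |f x| ≤ C) : Integrable f μ :=
  Integrable.of_bound hf.aestronglyMeasurable C (Filter.Eventually.of_forall h)

/-- A reverse Jensen inequality for `psi`. -/
lemma psi_integral_le {α : Type*} [MeasurableSpace α] {μ : Measure α} [IsProbabilityMeasure μ]
    {u : α → ℝ} (hm : Measurable u) (hu : Integrable u μ) (hu2 : Integrable (fun x => u x ^ 2) μ) :
    psi (∫ x, u x ∂μ) ≤ ∫ x, psi (u x) ∂μ
      + min (∫ x, u x ^ 2 ∂μ - (∫ x, u x ∂μ) ^ 2) (2 * Real.log 2) := by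
  set c := ∫ x, u x ∂μ with hc
  have hpsi : Integrable (fun x => psi (u x)) μ :=
    integrable_of_bounded (continuous_psi.measurable.comp hm) _ fun x => abs_psi_le _
  rw [← sub_le_iff_le_add', le_min_iff]
  constructor
  -- First bound: average the quadratic minorant of ψ at the mean c.
  · have hi0 : Integrable
        (fun x => psi c - psiDeriv c * c - c ^ 2 + (psiDeriv c + 2 * c) * u x) μ :=
      (integrable_const _).add (hu.const_mul _)
    have hi : Integrable
        (fun x => psi c - psiDeriv c * c - c ^ 2 + (psiDeriv c + 2 * c) * u x - u x ^ 2) μ :=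
      hi0.sub hu2
    have h := integral_mono hi hpsi fun x => by
      have := psi_add_sq_ge c (u x)
      simp only
      nlinarith
    rw [integral_sub hi0 hu2,
      integral_add (integrable_const _) (hu.const_mul _), integral_const_mul, ← hc] at h
    simp only [integral_const, probReal_univ, one_smul] at h
    nlinarith
  -- Second bound: two values of ψ differ by at most 2 log 2.
  · have h := integral_mono (integrable_const (-Real.log 2)) hpsi
      fun x => (abs_le.1 (abs_psi_le (u x))).1
    simp only [integral_const, probReal_univ, one_smul] at h
    linarith [psi_le_log_two c]

/-- The left side is a truncated variance p. The chord bound gives exp p ≤ 1 + 10aA² + 5a². The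
other 5a² on the right pays for the factor 1 + 5a²/4, since exp p ≤ 4; the logarithm of that factor
covers the subtracted term, which is the loss in `integral_log_gaussianReal_ge`. -/
lemma min_le_log_sub {a A : ℝ} (ha : 0 ≤ a) :
    min (4 * A ^ 2 * a + 2 * a ^ 2) (2 * Real.log 2)
      ≤ Real.log (1 + 10 * a ^ 2 + 10 * a * A ^ 2) - 10 * a ^ 2 / (8 * (1 + 10 * a ^ 2)) := by
  set p := min (4 * A ^ 2 * a + 2 * a ^ 2) (2 * Real.log 2) with hp
  have hp0 : 0 ≤ p := le_min (by positivity) (by positivity)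
  have hp1 : p ≤ 4 * A ^ 2 * a + 2 * a ^ 2 := min_le_left _ _
  have hp2 : p ≤ 2 * Real.log 2 := min_le_right _ _
  have he := exp_le_one_add_mul hp0 hp2
  have he4 : Real.exp p ≤ 4 := by
    have h4 : Real.exp (2 * Real.log 2) = 4 := by
      rw [two_mul, Real.exp_add, Real.exp_log (by norm_num)]; norm_num
    rw [← h4]; exact Real.exp_le_exp.2 hp2
  have h1 : Real.exp p * (1 + 5 * a ^ 2 / 4) ≤ 1 + 10 * a ^ 2 + 10 * a * A ^ 2 := by
    nlinarith [sq_nonneg a]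
  have h2 := Real.log_le_log (by positivity) h1
  rw [Real.log_mul (by positivity) (by positivity), Real.log_exp] at h2
  have h3 := Real.one_sub_inv_le_log_of_pos (by positivity : 0 < 1 + 5 * a ^ 2 / 4)
  have h4 : 10 * a ^ 2 / (8 * (1 + 10 * a ^ 2)) ≤ 1 - (1 + 5 * a ^ 2 / 4)⁻¹ := by
    rw [show 1 - (1 + 5 * a ^ 2 / 4)⁻¹ = 5 * a ^ 2 / (4 + 5 * a ^ 2) by field_simp; ring,
      div_le_div_iff₀ (by positivity) (by positivity)]
    nlinarith [sq_nonneg a, sq_nonneg (a ^ 2)]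
  linarith

variable (a : ℝ≥0) (A l σ : ℝ)

lemma integrable_log_gaussianReal :
    Integrable (fun y : ℝ => Real.log (1 + 10 * a ^ 2 + 10 * a * (A + y) ^ 2))
      (gaussianReal 0 a) := by
  refine Integrable.mono' (integral_polynomial_gaussianReal a
    (10 * a ^ 2 + 10 * a * A ^ 2) (20 * a * A) (10 * a) 0 0).1
    (Measurable.aestronglyMeasurable (by fun_prop)) ?_
  filter_upwards with y
  have h1 : 1 ≤ 1 + 10 * (a : ℝ) ^ 2 + 10 * a * (A + y) ^ 2 := by
    have : 0 ≤ 10 * (a : ℝ) ^ 2 + 10 * a * (A + y) ^ 2 := by positivity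
    linarith
  rw [Real.norm_eq_abs, abs_of_nonneg (Real.log_nonneg h1)]
  have := Real.log_le_sub_one_of_pos (by linarith : 0 < 1 + 10 * (a : ℝ) ^ 2 + 10 * a * (A + y) ^ 2)
  linarith

lemma integral_log_gaussianReal_ge :
    Real.log (1 + 10 * a ^ 2 + 10 * a * A ^ 2) - 10 * a ^ 2 / (8 * (1 + 10 * a ^ 2))
      ≤ ∫ y, Real.log (1 + 10 * a ^ 2 + 10 * a * (A + y) ^ 2) ∂gaussianReal 0 a := by
  set b : ℝ := 1 + 10 * (a : ℝ) ^ 2 with hb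
  have hb0 : 0 < b := by positivity
  set k := √(10 * a / b) with hk
  have hk2 : k ^ 2 = 10 * a / b := Real.sq_sqrt (by positivity)
  have hlog : ∀ x : ℝ, Real.log (b + 10 * a * x ^ 2)
      = Real.log b + Real.log (1 + (k * x) ^ 2) := fun x => by
    rw [← Real.log_mul hb0.ne' (by positivity), mul_pow, hk2]
    congr 1; field_simp
  have hP := integral_polynomial_gaussianReal a (Real.log b + Real.log (1 + (k * A) ^ 2))
    (2 * (k * A) / (1 + (k * A) ^ 2) * k) (- k ^ 2 / 8) 0 0
  -- Average the quadratic minorant of log(1 + s²) at s = kA: the linear term vanishes and the loss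
  -- is k²a/8.
  have h := integral_mono hP.1 (integrable_log_gaussianReal a A) fun y => by
    have := log_one_add_sq_ge (k * A) (k * (A + y))
    rw [show k * (A + y) - k * A = k * y by ring] at this
    have h2 := hlog (A + y)
    simp only
    rw [← hb, h2]
    nlinarith
  rw [hP.2] at h
  refine le_trans (le_of_eq ?_) h
  rw [hlog, hk2]
  field_simp
  ring

/-- The value of `psi` at `σ (A² - l)` is controlled by a Gaussian average. -/
lemma psi_le_integral_gaussianReal (hσ : σ ^ 2 = 1) :
    psi (σ * (A ^ 2 - l)) ≤ ∫ y, (psi (σ * ((A + y) ^ 2 - a - l))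
      + Real.log (1 + 10 * a ^ 2 + 10 * a * (A + y) ^ 2)) ∂gaussianReal 0 a := by
  have hm : Measurable fun y : ℝ => σ * ((A + y) ^ 2 - a - l) := by fun_prop
  have e1 : (fun y : ℝ => σ * ((A + y) ^ 2 - a - l)) = fun y =>
      σ * (A ^ 2 - a - l) + (2 * σ * A) * y + σ * y ^ 2 + 0 * y ^ 3 + 0 * y ^ 4 := by
    ext y; ring
  have e2 : (fun y : ℝ => (σ * ((A + y) ^ 2 - a - l)) ^ 2) = fun y =>
      (A ^ 2 - a - l) ^ 2 + (4 * A * (A ^ 2 - a - l)) * y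
      + (4 * A ^ 2 + 2 * (A ^ 2 - a - l)) * y ^ 2 + 4 * A * y ^ 3 + 1 * y ^ 4 := by
    ext y; rw [mul_pow, hσ]; ring
  have h1 := integral_polynomial_gaussianReal a (σ * (A ^ 2 - a - l)) (2 * σ * A) σ 0 0
  have h2 := integral_polynomial_gaussianReal a ((A ^ 2 - a - l) ^ 2)
    (4 * A * (A ^ 2 - a - l)) (4 * A ^ 2 + 2 * (A ^ 2 - a - l)) (4 * A) 1
  rw [← e1] at h1
  rw [← e2] at h2
  have h := psi_integral_le hm h1.1 h2.1
  have e3 : σ * (A ^ 2 - a - l) + σ * a + 3 * 0 * (a : ℝ) ^ 2 = σ * (A ^ 2 - l) := by ring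
  -- The variance of (A + y)² under N(0, a) is 4A²a + 2a².
  rw [h1.2, h2.2, e3, mul_pow, hσ, show (A ^ 2 - ↑a - l) ^ 2
      + (4 * A ^ 2 + 2 * (A ^ 2 - ↑a - l)) * ↑a + 3 * 1 * (a : ℝ) ^ 2 - 1 * (A ^ 2 - l) ^ 2
      = 4 * A ^ 2 * a + 2 * a ^ 2 by ring] at h
  have hpsi : Integrable (fun y : ℝ => psi (σ * ((A + y) ^ 2 - a - l))) (gaussianReal 0 a) :=
    integrable_of_bounded (continuous_psi.measurable.comp hm) _ fun x => abs_psi_le _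
  rw [integral_add hpsi (integrable_log_gaussianReal a A)]
  linarith [min_le_log_sub (A := A) a.coe_nonneg, integral_log_gaussianReal_ge a A]

/-- Half the variance 4A²a + 2a² turns 20aA² into 22aA², and 20a² + 20a·a into 41a². -/
lemma integral_quadratic_gaussianReal :
    ∫ y, (σ * ((A + y) ^ 2 - a - l) + ((A + y) ^ 2 - a - l) ^ 2 / 2 + 20 * a ^ 2
        + 20 * a * (A + y) ^ 2) ∂gaussianReal 0 a
      = σ * (A ^ 2 - l) + (A ^ 2 - l) ^ 2 / 2 + 22 * a * A ^ 2 + 41 * (a : ℝ) ^ 2 := by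
  have h := (integral_polynomial_gaussianReal a
    (σ * (A ^ 2 - a - l) + (A ^ 2 - a - l) ^ 2 / 2 + 20 * a ^ 2 + 20 * a * A ^ 2)
    (2 * σ * A + 2 * A * (A ^ 2 - a - l) + 40 * a * A)
    (σ + 2 * A ^ 2 + (A ^ 2 - a - l) + 20 * a) (2 * A) (1 / 2)).2
  convert h using 1
  · congr 1; ext y; ring
  · ring

/-- The factor exp ψ ≤ 2 multiplies the added terms, which is why 10 becomes 20. -/
lemma exp_psi_add_log_le {h m b : ℝ} (hb : 0 ≤ b) (hσ : σ ^ 2 = 1) :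
    Real.exp (psi (σ * h) + Real.log (1 + 10 * b ^ 2 + 10 * b * m ^ 2))
      ≤ 1 + (σ * h + h ^ 2 / 2 + 20 * b ^ 2 + 20 * b * m ^ 2) := by
  rw [Real.exp_add, Real.exp_log (by positivity)]
  have h1 := exp_psi_le (σ * h)
  have h2 := exp_psi_le_two (σ * h)
  rw [mul_pow, hσ] at h1
  have h3 : 0 ≤ 10 * b ^ 2 + 10 * b * m ^ 2 := by positivity
  nlinarith

end RobustCov

namespace RobustCov

open scoped ENNReal NNReal

/-! ### The smoothed exponent for vector parameters. -/

section Smoothing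

variable {ι : Type*} [Fintype ι] (σ l b : ℝ)

/-- The exponent used in the PAC-Bayesian bound, for the parameter `w` and the observation `z`. -/
noncomputable def smoothExponent (w z : EuclideanSpace ℝ ι) : ℝ :=
  psi (σ * (inner ℝ w z ^ 2 - ‖b • z‖ ^ 2 - l))
    + Real.log (1 + 10 * (‖b • z‖ ^ 2) ^ 2 + 10 * ‖b • z‖ ^ 2 * inner ℝ w z ^ 2)

/-- A polynomial that dominates `exp (smoothExponent σ l b w z) - 1`. -/
noncomputable def smoothPoly (w z : EuclideanSpace ℝ ι) : ℝ :=
  σ * (inner ℝ w z ^ 2 - ‖b • z‖ ^ 2 - l) + (inner ℝ w z ^ 2 - ‖b • z‖ ^ 2 - l) ^ 2 / 2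
    + 20 * (‖b • z‖ ^ 2) ^ 2 + 20 * ‖b • z‖ ^ 2 * inner ℝ w z ^ 2

lemma exp_smoothExponent_le (hσ : σ ^ 2 = 1) (w z : EuclideanSpace ℝ ι) :
    Real.exp (smoothExponent σ l b w z) ≤ 1 + smoothPoly σ l b w z :=
  exp_psi_add_log_le σ (by positivity) hσ

lemma measurable_smoothExponent :
    Measurable fun p : EuclideanSpace ℝ ι × EuclideanSpace ℝ ι =>
      smoothExponent σ l b p.1 p.2 := by
  unfold smoothExponent
  refine Measurable.add (continuous_psi.measurable.comp ?_) (Measurable.log ?_)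
  · exact Continuous.measurable (by fun_prop)
  · exact Continuous.measurable (by fun_prop)

lemma continuous_smoothPoly :
    Continuous fun p : EuclideanSpace ℝ ι × EuclideanSpace ℝ ι =>
      smoothPoly σ l b p.1 p.2 := by
  unfold smoothPoly
  fun_prop

/-- A crude domination, serving only integrability and the exchange of integrals. -/
lemma abs_smoothPoly_le (hσ : σ ^ 2 = 1) (w z : EuclideanSpace ℝ ι) :
    |smoothPoly σ l b w z| ≤ (1 / 2 + 3 * l ^ 2)
      + (3 * ‖w‖ ^ 4 + 23 * b ^ 4 + 20 * b ^ 2 * ‖w‖ ^ 2) * ‖z‖ ^ 4 := by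
  unfold smoothPoly
  have hm : inner ℝ w z ^ 2 ≤ ‖w‖ ^ 2 * ‖z‖ ^ 2 := by
    rw [← mul_pow, ← sq_abs]
    exact pow_le_pow_left₀ (abs_nonneg _) (abs_real_inner_le_norm w z) 2
  have ha : ‖b • z‖ ^ 2 = b ^ 2 * ‖z‖ ^ 2 := by
    rw [norm_smul, mul_pow, Real.norm_eq_abs, sq_abs]
  rw [ha]
  set m := (inner ℝ w z) ^ 2
  have hm0 : 0 ≤ m := sq_nonneg _
  have hm2 : m ^ 2 ≤ ‖w‖ ^ 4 * ‖z‖ ^ 4 := by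
    calc m ^ 2 ≤ (‖w‖ ^ 2 * ‖z‖ ^ 2) ^ 2 := pow_le_pow_left₀ hm0 hm 2
      _ = _ := by ring
  set a := b ^ 2 * ‖z‖ ^ 2 with ha'
  have ha0 : 0 ≤ a := by positivity
  have ham : a * m ≤ b ^ 2 * ‖w‖ ^ 2 * ‖z‖ ^ 4 := by
    calc a * m ≤ a * (‖w‖ ^ 2 * ‖z‖ ^ 2) := mul_le_mul_of_nonneg_left hm ha0
      _ = _ := by rw [ha']; ring
  have ha2 : a ^ 2 = b ^ 4 * ‖z‖ ^ 4 := by rw [ha']; ring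
  have hh : (m - a - l) ^ 2 ≤ 3 * (m ^ 2 + a ^ 2 + l ^ 2) := by
    nlinarith [sq_nonneg (m + a), sq_nonneg (m + l), sq_nonneg (a - l)]
  have hs1 : σ * (m - a - l) ≤ 1 / 2 + (m - a - l) ^ 2 / 2 := by
    nlinarith [sq_nonneg (σ - (m - a - l))]
  have hs2 : -(σ * (m - a - l)) ≤ 1 / 2 + (m - a - l) ^ 2 / 2 := by
    nlinarith [sq_nonneg (σ + (m - a - l))]
  have hamn : 0 ≤ a * m := mul_nonneg ha0 hm0
  rw [abs_le]
  constructor <;> nlinarith [sq_nonneg a, sq_nonneg (m - a - l)]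

variable {σ l b}

/-- Only the marginal of the Gaussian along z matters; its variance is ‖b z‖². -/
lemma integral_stdGaussian_inner (t z : EuclideanSpace ℝ ι) {f : ℝ → ℝ} (hf : Measurable f) :
    ∫ g, f (inner ℝ (b • (g + t)) z) ∂stdGaussian (EuclideanSpace ℝ ι)
      = ∫ y, f (inner ℝ (b • t) z + y) ∂gaussianReal 0 (‖b • z‖₊ ^ 2) := by
  rw [← stdGaussian_map_inner, integral_map (by fun_prop)
    (Measurable.aestronglyMeasurable (by fun_prop))]
  congr 1
  ext g
  rw [smul_add, inner_add_left, real_inner_smul_left g z b, real_inner_smul_left z g b,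
    real_inner_comm g z, add_comm]

lemma integrable_stdGaussian_inner (t z : EuclideanSpace ℝ ι) {f : ℝ → ℝ} (hf : Measurable f)
    (hi : Integrable (fun y => f (inner ℝ (b • t) z + y)) (gaussianReal 0 (‖b • z‖₊ ^ 2))) :
    Integrable (fun g => f (inner ℝ (b • (g + t)) z)) (stdGaussian (EuclideanSpace ℝ ι)) := by
  rw [← stdGaussian_map_inner, integrable_map_measure
    (Measurable.aestronglyMeasurable (by fun_prop)) (by fun_prop)] at hi
  refine hi.congr (Filter.Eventually.of_forall fun g => ?_)
  simp only [Function.comp]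
  rw [smul_add, inner_add_left, real_inner_smul_left g z b, real_inner_smul_left z g b,
    real_inner_comm g z, add_comm]

lemma integrable_smoothExponent (t z : EuclideanSpace ℝ ι) :
    Integrable (fun g => smoothExponent σ l b (b • (g + t)) z)
      (stdGaussian (EuclideanSpace ℝ ι)) := by
  refine integrable_stdGaussian_inner t z (f := fun m => psi (σ * (m ^ 2 - ‖b • z‖ ^ 2 - l))
    + Real.log (1 + 10 * (‖b • z‖ ^ 2) ^ 2 + 10 * ‖b • z‖ ^ 2 * m ^ 2)) ?_ ?_
  · exact (continuous_psi.measurable.comp (by fun_prop)).add (by fun_prop)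
  · refine Integrable.add (integrable_of_bounded (continuous_psi.measurable.comp (by fun_prop)) _
      fun x => abs_psi_le _) ?_
    have h := integrable_log_gaussianReal (‖b • z‖₊ ^ 2) (inner ℝ (b • t) z)
    simp only [NNReal.coe_pow, coe_nnnorm] at h
    exact h

lemma psi_le_integral_smoothExponent (hσ : σ ^ 2 = 1) (t z : EuclideanSpace ℝ ι) :
    psi (σ * (inner ℝ (b • t) z ^ 2 - l))
      ≤ ∫ g, smoothExponent σ l b (b • (g + t)) z ∂stdGaussian (EuclideanSpace ℝ ι) := by
  have h := psi_le_integral_gaussianReal (‖b • z‖₊ ^ 2) (inner ℝ (b • t) z) l σ hσ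
  have h2 := integral_stdGaussian_inner (b := b) t z
    (f := fun m => psi (σ * (m ^ 2 - ‖b • z‖ ^ 2 - l))
    + Real.log (1 + 10 * (‖b • z‖ ^ 2) ^ 2 + 10 * ‖b • z‖ ^ 2 * m ^ 2))
    ((continuous_psi.measurable.comp (by fun_prop)).add (by fun_prop))
  unfold smoothExponent
  rw [h2]
  simpa using h

lemma integral_smoothPoly (t z : EuclideanSpace ℝ ι) :
    ∫ g, smoothPoly σ l b (b • (g + t)) z ∂stdGaussian (EuclideanSpace ℝ ι)
      = σ * (inner ℝ (b • t) z ^ 2 - l) + (inner ℝ (b • t) z ^ 2 - l) ^ 2 / 2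
        + 22 * ‖b • z‖ ^ 2 * inner ℝ (b • t) z ^ 2 + 41 * (‖b • z‖ ^ 2) ^ 2 := by
  have h := integral_quadratic_gaussianReal (‖b • z‖₊ ^ 2) (inner ℝ (b • t) z) l σ
  have h2 := integral_stdGaussian_inner (b := b) t z
    (f := fun m => σ * (m ^ 2 - ‖b • z‖ ^ 2 - l) + (m ^ 2 - ‖b • z‖ ^ 2 - l) ^ 2 / 2
    + 20 * (‖b • z‖ ^ 2) ^ 2 + 20 * ‖b • z‖ ^ 2 * m ^ 2) (by fun_prop)
  unfold smoothPoly
  rw [h2]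
  simpa using h

end Smoothing

/-! ### Fourth moments of a vector with directional kurtosis control. -/

section Moments

variable {E : Type*} [MeasurableSpace E] {ν : Measure E}
  {ι : Type*} [Fintype ι] {Z : E → EuclideanSpace ℝ ι} {K : ℝ}

lemma norm_pow_four_le (z : EuclideanSpace ℝ ι) :
    ‖z‖ ^ 4 ≤ Fintype.card ι * ∑ j, z j ^ 4 := by
  have h := sq_sum_le_card_mul_sum_sq (s := Finset.univ) (f := fun j => z j ^ 2)
  rw [← EuclideanSpace.real_norm_sq_eq] at h
  simp only [← pow_mul, Finset.card_univ] at h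
  exact h

lemma integrable_norm_pow_four (hZ : Measurable Z)
    (hK : ∀ v : EuclideanSpace ℝ ι, Integrable (fun x => inner ℝ v (Z x) ^ 4) ν ∧
      ∫ x, inner ℝ v (Z x) ^ 4 ∂ν ≤ K * ‖v‖ ^ 4) :
    Integrable (fun x => ‖Z x‖ ^ 4) ν ∧
    ∫ x, ‖Z x‖ ^ 4 ∂ν ≤ K * Fintype.card ι ^ 2 := by
  classical
  have hj : ∀ j, Integrable (fun x => Z x j ^ 4) ν ∧ ∫ x, Z x j ^ 4 ∂ν ≤ K := fun j => by
    simpa [EuclideanSpace.inner_single_left] using hK (EuclideanSpace.single j 1)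
  have hs : Integrable (fun x => Fintype.card ι * ∑ j, Z x j ^ 4) ν :=
    (integrable_finsetSum _ fun j _ => (hj j).1).const_mul _
  have hi : Integrable (fun x => ‖Z x‖ ^ 4) ν :=
    hs.mono' (by fun_prop) (Filter.Eventually.of_forall fun x => by
      rw [Real.norm_eq_abs, abs_of_nonneg (by positivity)]
      exact norm_pow_four_le _)
  refine ⟨hi, (integral_mono hi hs fun x => norm_pow_four_le _).trans ?_⟩
  rw [integral_const_mul, integral_finsetSum _ fun j _ => (hj j).1]
  have h := Finset.sum_le_sum fun j (_ : j ∈ Finset.univ) => (hj j).2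
  rw [Finset.sum_const, Finset.card_univ, nsmul_eq_mul] at h
  calc _ ≤ (Fintype.card ι : ℝ) * (Fintype.card ι * K) :=
        mul_le_mul_of_nonneg_left h (by positivity)
    _ = _ := by ring

lemma integrable_inner_sq [IsProbabilityMeasure ν] (hZ : Measurable Z)
    (hK : ∀ v : EuclideanSpace ℝ ι, Integrable (fun x => inner ℝ v (Z x) ^ 4) ν ∧
      ∫ x, inner ℝ v (Z x) ^ 4 ∂ν ≤ K * ‖v‖ ^ 4)
    (v : EuclideanSpace ℝ ι) :
    Integrable (fun x => inner ℝ v (Z x) ^ 2) ν := by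
  refine Integrable.mono' ((integrable_const (1 : ℝ)).add (hK v).1) (by fun_prop)
    (Filter.Eventually.of_forall fun x => ?_)
  rw [Real.norm_eq_abs, abs_of_nonneg (by positivity)]
  simp only [Pi.add_apply]
  nlinarith [sq_nonneg ((inner ℝ v (Z x)) ^ 2 - 1)]

lemma integrable_norm_sq_mul_inner_sq (hZ : Measurable Z)
    (hK : ∀ v : EuclideanSpace ℝ ι, Integrable (fun x => inner ℝ v (Z x) ^ 4) ν ∧
      ∫ x, inner ℝ v (Z x) ^ 4 ∂ν ≤ K * ‖v‖ ^ 4)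
    (v : EuclideanSpace ℝ ι) :
    Integrable (fun x => ‖Z x‖ ^ 2 * inner ℝ v (Z x) ^ 2) ν ∧
      ∫ x, ‖Z x‖ ^ 2 * inner ℝ v (Z x) ^ 2 ∂ν ≤ K * ‖v‖ ^ 2 * Fintype.card ι := by
  have hN := integrable_norm_pow_four hZ hK
  have hi : Integrable (fun x => ‖Z x‖ ^ 2 * inner ℝ v (Z x) ^ 2) ν := by
    refine Integrable.mono' (hN.1.add (hK v).1) (by fun_prop)
      (Filter.Eventually.of_forall fun x => ?_)
    rw [Real.norm_eq_abs, abs_of_nonneg (by positivity)]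
    simp only [Pi.add_apply]
    nlinarith [sq_nonneg ((inner ℝ v (Z x)) ^ 2 - ‖Z x‖ ^ 2), sq_nonneg ((inner ℝ v (Z x)) ^ 2),
      sq_nonneg (‖Z x‖ ^ 2)]
  refine ⟨hi, ?_⟩
  rcases eq_or_ne v 0 with rfl | hv
  · simp
  have hs : 0 < ‖v‖ ^ 2 := by positivity
  have hD : 0 < (Fintype.card ι : ℝ) := by
    rcases isEmpty_or_nonempty ι with h | h
    · exact absurd (Subsingleton.elim v 0) hv
    · exact_mod_cast Fintype.card_pos
  set D : ℝ := (Fintype.card ι : ℝ)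
  -- Weighted arithmetic-geometric means replace Cauchy–Schwarz; this weight makes the two resulting
  -- bounds equal.
  set α := D / ‖v‖ ^ 2 with hα
  have hα0 : 0 < α := by positivity
  have hpt : ∀ x, ‖Z x‖ ^ 2 * inner ℝ v (Z x) ^ 2
      ≤ α / 2 * inner ℝ v (Z x) ^ 4 + 1 / (2 * α) * ‖Z x‖ ^ 4 := fun x => by
    have : α / 2 * inner ℝ v (Z x) ^ 4 + 1 / (2 * α) * ‖Z x‖ ^ 4
        - ‖Z x‖ ^ 2 * inner ℝ v (Z x) ^ 2
        = (α * inner ℝ v (Z x) ^ 2 - ‖Z x‖ ^ 2) ^ 2 / (2 * α) := by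
      field_simp; ring
    have h2 : 0 ≤ (α * inner ℝ v (Z x) ^ 2 - ‖Z x‖ ^ 2) ^ 2 / (2 * α) := by positivity
    linarith
  have i1 := (hK v).1.const_mul (α / 2)
  have i2 := hN.1.const_mul (1 / (2 * α))
  refine (integral_mono hi (i1.add i2) hpt).trans ?_
  rw [integral_add' i1 i2, integral_const_mul, integral_const_mul]
  have h1 := mul_le_mul_of_nonneg_left (hK v).2 (by positivity : 0 ≤ α / 2)
  have h2 := mul_le_mul_of_nonneg_left hN.2 (by positivity : 0 ≤ 1 / (2 * α))
  have e1 : α / 2 * (K * ‖v‖ ^ 4) = K * ‖v‖ ^ 2 * D / 2 := by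
    rw [hα]; field_simp
  have e2 : 1 / (2 * α) * (K * D ^ 2) = K * ‖v‖ ^ 2 * D / 2 := by
    rw [hα]; field_simp
  linarith

/-- The integrated second order expansion. -/
lemma integral_expansion_le [IsProbabilityMeasure ν] (hZ : Measurable Z)
    (hK : ∀ v : EuclideanSpace ℝ ι, Integrable (fun x => inner ℝ v (Z x) ^ 4) ν ∧
      ∫ x, inner ℝ v (Z x) ^ 4 ∂ν ≤ K * ‖v‖ ^ 4)
    {σ l b : ℝ} (v : EuclideanSpace ℝ ι)
    (hv : ∫ x, inner ℝ v (Z x) ^ 2 ∂ν = ‖v‖ ^ 2) :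
    ∫ x, (σ * (inner ℝ v (Z x) ^ 2 - l) + (inner ℝ v (Z x) ^ 2 - l) ^ 2 / 2
        + 22 * ‖b • Z x‖ ^ 2 * inner ℝ v (Z x) ^ 2 + 41 * (‖b • Z x‖ ^ 2) ^ 2) ∂ν
      ≤ σ * (‖v‖ ^ 2 - l) + (K * ‖v‖ ^ 4 - 2 * l * ‖v‖ ^ 2 + l ^ 2) / 2
        + 22 * b ^ 2 * (K * ‖v‖ ^ 2 * Fintype.card ι)
        + 41 * b ^ 4 * (K * Fintype.card ι ^ 2) := by
  have hN := integrable_norm_pow_four hZ hK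
  have hM := integrable_norm_sq_mul_inner_sq hZ hK v
  have hQ := integrable_inner_sq hZ hK v
  have e : ∀ x, σ * (inner ℝ v (Z x) ^ 2 - l) + (inner ℝ v (Z x) ^ 2 - l) ^ 2 / 2
        + 22 * ‖b • Z x‖ ^ 2 * inner ℝ v (Z x) ^ 2 + 41 * (‖b • Z x‖ ^ 2) ^ 2
      = (l ^ 2 / 2 - σ * l) + (σ - l) * inner ℝ v (Z x) ^ 2 + 1 / 2 * inner ℝ v (Z x) ^ 4
        + 22 * b ^ 2 * (‖Z x‖ ^ 2 * inner ℝ v (Z x) ^ 2) + 41 * b ^ 4 * ‖Z x‖ ^ 4 := fun x => by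
    rw [norm_smul, mul_pow, Real.norm_eq_abs, sq_abs]; ring
  simp_rw [e]
  have i0 : Integrable (fun _ : E => l ^ 2 / 2 - σ * l) ν := integrable_const _
  have i1 : Integrable (fun x => (l ^ 2 / 2 - σ * l) + (σ - l) * inner ℝ v (Z x) ^ 2) ν :=
    i0.add (hQ.const_mul _)
  have i2 : Integrable (fun x => (l ^ 2 / 2 - σ * l) + (σ - l) * inner ℝ v (Z x) ^ 2
      + 1 / 2 * inner ℝ v (Z x) ^ 4) ν := i1.add ((hK v).1.const_mul _)
  have i3 : Integrable (fun x => (l ^ 2 / 2 - σ * l) + (σ - l) * inner ℝ v (Z x) ^ 2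
      + 1 / 2 * inner ℝ v (Z x) ^ 4 + 22 * b ^ 2 * (‖Z x‖ ^ 2 * inner ℝ v (Z x) ^ 2)) ν :=
    i2.add (hM.1.const_mul _)
  rw [integral_add i3 (hN.1.const_mul _), integral_add i2 (hM.1.const_mul _),
    integral_add i1 ((hK v).1.const_mul _), integral_add i0 (hQ.const_mul _)]
  simp only [integral_const_mul, integral_const, probReal_univ, one_smul, hv]
  have h1 := mul_le_mul_of_nonneg_left hM.2 (by positivity : 0 ≤ 22 * b ^ 2)
  have h2 := mul_le_mul_of_nonneg_left hN.2 (by positivity : 0 ≤ 41 * b ^ 4)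
  linarith [(hK v).2]

end Moments

end RobustCov

/-! ### The uniform deviation bound for sums of ψ. -/

namespace RobustCov

open scoped ENNReal NNReal

variable {E : Type*} [MeasurableSpace E] {ν : Measure E} [IsProbabilityMeasure ν]
  {ι : Type*} [Fintype ι] {Z : E → EuclideanSpace ℝ ι} {K σ l b : ℝ}

lemma integrable_smoothPoly_prod (hσ : σ ^ 2 = 1) (hZ : Measurable Z)
    (hK : Integrable (fun x => ‖Z x‖ ^ 4) ν) (t : EuclideanSpace ℝ ι) :
    Integrable (fun p : EuclideanSpace ℝ ι × E => smoothPoly σ l b (b • (p.1 + t)) (Z p.2))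
      ((stdGaussian (EuclideanSpace ℝ ι)).prod ν) := by
  set γ := stdGaussian (EuclideanSpace ℝ ι)
  have hpow : ∀ n : ℕ, Integrable (fun g : EuclideanSpace ℝ ι => ‖b • (g + t)‖ ^ n) γ := fun n => by
    have h1 : MemLp (fun g : EuclideanSpace ℝ ι => b • (g + t)) n γ :=
      ((IsGaussian.memLp_id γ n (by simp)).add (memLp_const t)).const_smul b
    exact h1.integrable_norm_pow'
  have hg : Integrable (fun g : EuclideanSpace ℝ ι => 3 * ‖b • (g + t)‖ ^ 4 + 23 * b ^ 4
      + 20 * b ^ 2 * ‖b • (g + t)‖ ^ 2) γ :=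
    (((hpow 4).const_mul 3).add (integrable_const _)).add ((hpow 2).const_mul _)
  refine Integrable.mono' ((integrable_const (1 / 2 + 3 * l ^ 2)).add (hg.mul_prod hK)) ?_
    (Filter.Eventually.of_forall fun p => abs_smoothPoly_le σ l b hσ _ _)
  exact ((continuous_smoothPoly σ l b).measurable.comp
    (f := fun p : EuclideanSpace ℝ ι × E => (b • (p.1 + t), Z p.2)) (by fun_prop)).aestronglyMeasurable

/-- The exponential moment of the centered sum of the exponents is at most one. -/
lemma lintegral_exp_sum_smoothExponent_le {n : ℕ} (hσ : σ ^ 2 = 1) (hZ : Measurable Z)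
    (w : EuclideanSpace ℝ ι) (hi : Integrable (fun x => smoothPoly σ l b w (Z x)) ν) :
    ∫⁻ x, ENNReal.ofReal (Real.exp (∑ i, smoothExponent σ l b w (Z (x i))
      - n * ∫ x, smoothPoly σ l b w (Z x) ∂ν)) ∂(Measure.pi fun _ : Fin n => ν) ≤ 1 := by
  set R := ∫ x, smoothPoly σ l b w (Z x) ∂ν with hR
  have hm : Measurable fun x => ENNReal.ofReal (Real.exp (smoothExponent σ l b w (Z x))) :=
    (Real.measurable_exp.comp ((measurable_smoothExponent σ l b).comp
      (f := fun x => (w, Z x)) (by fun_prop))).ennreal_ofReal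
  -- Per observation, the exponential moment is at most 1 + R ≤ exp R; independence then multiplies
  -- these bounds.
  have h1 : ∫⁻ x, ENNReal.ofReal (Real.exp (smoothExponent σ l b w (Z x))) ∂ν
      ≤ ENNReal.ofReal (Real.exp R) := by
    calc _ ≤ ∫⁻ x, ENNReal.ofReal (1 + smoothPoly σ l b w (Z x)) ∂ν :=
          lintegral_mono fun x => ENNReal.ofReal_le_ofReal (exp_smoothExponent_le σ l b hσ _ _)
      _ = ENNReal.ofReal (∫ x, (1 + smoothPoly σ l b w (Z x)) ∂ν) :=
          (ofReal_integral_eq_lintegral_ofReal ((integrable_const 1).add hi)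
            (Filter.Eventually.of_forall fun x =>
              (Real.exp_pos _).le.trans (exp_smoothExponent_le σ l b hσ _ _))).symm
      _ ≤ _ := by
          rw [integral_add (integrable_const 1) hi, ← hR]
          refine ENNReal.ofReal_le_ofReal ?_
          simp only [integral_const, probReal_univ, one_smul]
          linarith [Real.add_one_le_exp R]
  have hind := iIndepFun_pi (μ := fun _ : Fin n => ν)
    (X := fun _ x => ENNReal.ofReal (Real.exp (smoothExponent σ l b w (Z x))))
    fun i => hm.aemeasurable
  have h2 := lintegral_prod_eq_prod_lintegral_of_indepFun Finset.univ _ hind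
    fun i => hm.comp (measurable_pi_apply i)
  have h3 : ∀ x : Fin n → E, ENNReal.ofReal (Real.exp (∑ i, smoothExponent σ l b w (Z (x i))
      - n * R)) = ENNReal.ofReal (Real.exp (-(n * R)))
        * ∏ i, ENNReal.ofReal (Real.exp (smoothExponent σ l b w (Z (x i)))) := fun x => by
    rw [← ENNReal.ofReal_prod_of_nonneg fun i _ => (Real.exp_pos _).le,
      ← ENNReal.ofReal_mul (Real.exp_pos _).le, ← Real.exp_sum, ← Real.exp_add]
    congr 2; ring
  simp_rw [h3]
  rw [lintegral_const_mul' _ _ ENNReal.ofReal_ne_top, h2]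
  have h4 : ∀ i : Fin n, ∫⁻ x, ENNReal.ofReal (Real.exp (smoothExponent σ l b w (Z (x i))))
      ∂(Measure.pi fun _ : Fin n => ν) ≤ ENNReal.ofReal (Real.exp R) := fun i =>
    ((measurePreserving_eval (fun _ : Fin n => ν) i).lintegral_comp hm).trans_le h1
  calc _ ≤ ENNReal.ofReal (Real.exp (-(n * R))) * ∏ i : Fin n, ENNReal.ofReal (Real.exp R) := by
        gcongr with i
        exact h4 i
    _ = 1 := by
        rw [Finset.prod_const, Finset.card_univ, Fintype.card_fin,
          ← ENNReal.ofReal_pow (Real.exp_pos _).le, ← ENNReal.ofReal_mul (Real.exp_pos _).le,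
          ← Real.exp_nat_mul, ← Real.exp_add]
        simp

/-- The uniform deviation bound for the truncated quadratic forms, in one direction. -/
theorem exists_event_sum_psi_le {n : ℕ} (hσ : σ ^ 2 = 1) (hb : 0 < b) {ε : ℝ} (hε : 0 < ε)
    (hZ : Measurable Z)
    (hK : ∀ v : EuclideanSpace ℝ ι, Integrable (fun x => inner ℝ v (Z x) ^ 4) ν ∧
      ∫ x, inner ℝ v (Z x) ^ 4 ∂ν ≤ K * ‖v‖ ^ 4) :
    ∃ G : Set (Fin n → E), MeasurableSet G ∧
      (Measure.pi fun _ : Fin n => ν) Gᶜ ≤ ENNReal.ofReal ε ∧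
      ∀ x ∈ G, ∀ v : EuclideanSpace ℝ ι, ∫ x, inner ℝ v (Z x) ^ 2 ∂ν = ‖v‖ ^ 2 →
        ∑ i, psi (σ * (inner ℝ v (Z (x i)) ^ 2 - l))
          ≤ n * (σ * (‖v‖ ^ 2 - l) + (K * ‖v‖ ^ 4 - 2 * l * ‖v‖ ^ 2 + l ^ 2) / 2
            + 22 * b ^ 2 * (K * ‖v‖ ^ 2 * Fintype.card ι)
            + 41 * b ^ 4 * (K * Fintype.card ι ^ 2))
            + ‖v‖ ^ 2 / (2 * b ^ 2) + Real.log ε⁻¹ := by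
  set γ := stdGaussian (EuclideanSpace ℝ ι)
  have hN := (integrable_norm_pow_four hZ hK).1
  set R : EuclideanSpace ℝ ι → ℝ := fun w => ∫ x, smoothPoly σ l b w (Z x) ∂ν with hR
  have hRm : Measurable R := by
    have : StronglyMeasurable fun p : EuclideanSpace ℝ ι × E => smoothPoly σ l b p.1 (Z p.2) :=
      ((continuous_smoothPoly σ l b).measurable.comp
        (f := fun p : EuclideanSpace ℝ ι × E => (p.1, Z p.2)) (by fun_prop)).stronglyMeasurable
    exact this.integral_prod_right.measurable
  set H : EuclideanSpace ℝ ι → (Fin n → E) → ℝ := fun w x =>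
    ∑ i, smoothExponent σ l b w (Z (x i)) - n * R w with hH
  have hHm : Measurable fun p : EuclideanSpace ℝ ι × (Fin n → E) => H p.1 p.2 := by
    refine Measurable.sub (Finset.measurable_sum _ fun i _ => ?_) ((hRm.comp measurable_fst).const_mul _)
    exact (measurable_smoothExponent σ l b).comp
      (f := fun p : EuclideanSpace ℝ ι × (Fin n → E) => (p.1, Z (p.2 i))) (by fun_prop)
  have hem : Measurable fun p : EuclideanSpace ℝ ι × (Fin n → E) =>
      ENNReal.ofReal (Real.exp (H (b • p.1) p.2)) :=
    (Real.measurable_exp.comp (hHm.comp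
      (f := fun p : EuclideanSpace ℝ ι × (Fin n → E) => (b • p.1, p.2)) (by fun_prop))).ennreal_ofReal
  -- The exponential is averaged over the prior N(0, b² I). The good event constrains this one
  -- random variable, independently of v.
  set Φ : (Fin n → E) → ℝ≥0∞ := fun x => ∫⁻ g, ENNReal.ofReal (Real.exp (H (b • g) x)) ∂γ with hΦ
  have hΦm : Measurable Φ := hem.lintegral_prod_left'
  have hipoly : ∀ w : EuclideanSpace ℝ ι, Integrable (fun x => smoothPoly σ l b w (Z x)) ν :=
    fun w => by
      refine Integrable.mono' ((integrable_const (1 / 2 + 3 * l ^ 2)).add (hN.const_mul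
        (3 * ‖w‖ ^ 4 + 23 * b ^ 4 + 20 * b ^ 2 * ‖w‖ ^ 2))) ?_
        (Filter.Eventually.of_forall fun p => abs_smoothPoly_le σ l b hσ _ _)
      exact ((continuous_smoothPoly σ l b).measurable.comp
        (f := fun x : E => (w, Z x)) (by fun_prop)).aestronglyMeasurable
  have hΦint : ∫⁻ x, Φ x ∂(Measure.pi fun _ : Fin n => ν) ≤ 1 := by
    rw [hΦ, ← lintegral_lintegral_swap hem.aemeasurable]
    refine (lintegral_mono fun g => lintegral_exp_sum_smoothExponent_le hσ hZ (b • g)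
      (hipoly _)).trans ?_
    simp
  have hε' : ENNReal.ofReal ε⁻¹ = (ENNReal.ofReal ε)⁻¹ := ENNReal.ofReal_inv_of_pos hε
  refine ⟨{x | Φ x ≤ ENNReal.ofReal ε⁻¹}, measurableSet_le hΦm measurable_const, ?_, ?_⟩
  · have hc : {x | Φ x ≤ ENNReal.ofReal ε⁻¹}ᶜ ⊆ {x | ENNReal.ofReal ε⁻¹ ≤ Φ x} :=
      fun x hx => by
      simp only [Set.mem_compl_iff, Set.mem_ofPred_eq, not_le] at hx
      exact hx.le
    -- Markov's inequality at level 1/ε.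
    refine (measure_mono hc).trans ((meas_ge_le_lintegral_div hΦm.aemeasurable
      (by simpa using hε) ENNReal.ofReal_ne_top).trans ?_)
    rw [hε', div_eq_mul_inv, inv_inv]
    exact mul_le_of_le_one_left zero_le hΦint
  · intro x hx v hv
    -- The shift that moves the centre of b(g + t) to v; its entropy is ‖v‖²/(2b²).
    set t := b⁻¹ • v with ht
    have hbt : b • t = v := by rw [ht, smul_smul, mul_inv_cancel₀ hb.ne', one_smul]
    have hprod := integrable_smoothPoly_prod (l := l) (b := b) hσ hZ hN t
    have hRint : Integrable (fun g => R (b • (g + t))) γ := hprod.integral_prod_left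
    have hsum : Integrable (fun g => ∑ i, smoothExponent σ l b (b • (g + t)) (Z (x i))) γ :=
      integrable_finsetSum _ fun i _ => integrable_smoothExponent t _
    have hHint : Integrable (fun g => H (b • (g + t)) x) γ := hsum.sub (hRint.const_mul _)
    have hpac := integral_add_le_of_lintegral_exp_le (F := fun g => H (b • g) x)
      (hHm.comp (f := fun g => (b • g, x)) (by fun_prop)) hε hx t hHint
    have hHval : ∫ g, H (b • (g + t)) x ∂γ
        = ∑ i, ∫ g, smoothExponent σ l b (b • (g + t)) (Z (x i)) ∂γ
          - n * ∫ g, R (b • (g + t)) ∂γ := by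
      rw [← integral_finsetSum _ fun i _ => integrable_smoothExponent t _, ← integral_const_mul,
        ← integral_sub hsum (hRint.const_mul _)]
    have hRval : ∫ g, R (b • (g + t)) ∂γ
        ≤ σ * (‖v‖ ^ 2 - l) + (K * ‖v‖ ^ 4 - 2 * l * ‖v‖ ^ 2 + l ^ 2) / 2
            + 22 * b ^ 2 * (K * ‖v‖ ^ 2 * Fintype.card ι)
            + 41 * b ^ 4 * (K * Fintype.card ι ^ 2) := by
      have hswap := integral_integral_swap
        (f := fun g x => smoothPoly σ l b (b • (g + t)) (Z x)) hprod
      refine (hswap.trans (integral_congr_ae (Filter.Eventually.of_forall fun x => ?_))).trans_le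
        (integral_expansion_le hZ hK (σ := σ) (l := l) (b := b) v hv)
      have := integral_smoothPoly (σ := σ) (l := l) (b := b) t (Z x)
      rwa [hbt] at this
    have hpsi : ∑ i, psi (σ * (inner ℝ v (Z (x i)) ^ 2 - l))
        ≤ ∑ i, ∫ g, smoothExponent σ l b (b • (g + t)) (Z (x i)) ∂γ :=
      Finset.sum_le_sum fun i _ => by
        have := psi_le_integral_smoothExponent (l := l) (b := b) hσ t (Z (x i))
        rwa [hbt] at this
    have hnorm : ‖t‖ ^ 2 / 2 = ‖v‖ ^ 2 / (2 * b ^ 2) := by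
      rw [ht, norm_smul, norm_inv, Real.norm_eq_abs, mul_pow, inv_pow, sq_abs]
      field_simp
    rw [hHval, hnorm] at hpac
    have := mul_le_mul_of_nonneg_left hRval (Nat.cast_nonneg n : (0 : ℝ) ≤ n)
    linarith

end RobustCov

namespace RobustCov

open scoped ENNReal NNReal

/-! ### Kurtosis after translation by a constant. -/

section Kurtosis

variable {E : Type*} [MeasurableSpace E] {ν : Measure E} [IsProbabilityMeasure ν]

lemma integrable_of_integrable_pow_four {Y : E → ℝ} (hm : Measurable Y)
    (h4 : Integrable (fun x => Y x ^ 4) ν) :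
    Integrable Y ν ∧ Integrable (fun x => Y x ^ 2) ν := by
  constructor
  · refine Integrable.mono' ((integrable_const (1 : ℝ)).add h4) hm.aestronglyMeasurable
      (Filter.Eventually.of_forall fun x => ?_)
    simp only [Real.norm_eq_abs, Pi.add_apply]
    rw [abs_le]
    constructor <;> nlinarith [sq_nonneg (Y x ^ 2 - 1 / 2), sq_nonneg (Y x - 1 / 2), sq_nonneg (Y x + 1 / 2)]
  · refine Integrable.mono' ((integrable_const (1 : ℝ)).add h4) (by fun_prop)
      (Filter.Eventually.of_forall fun x => ?_)
    rw [Real.norm_eq_abs, abs_of_nonneg (by positivity)]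
    simp only [Pi.add_apply]
    nlinarith [sq_nonneg (Y x ^ 2 - 1)]

/-- The kurtosis of a translated centered variable. -/
lemma integral_add_const_pow_four_le {Y : E → ℝ} {κ : ℝ} (hκ : 0 < κ) (hm : Measurable Y)
    (h4 : Integrable (fun x => Y x ^ 4) ν) (h1 : ∫ x, Y x ∂ν = 0)
    (hk : ∫ x, Y x ^ 4 ∂ν ≤ κ * (∫ x, Y x ^ 2 ∂ν) ^ 2) (t : ℝ) :
    Integrable (fun x => (Y x + t) ^ 4) ν ∧
      ∫ x, (Y x + t) ^ 4 ∂ν ≤ (√κ + 1) ^ 2 * (∫ x, Y x ^ 2 ∂ν + t ^ 2) ^ 2 := by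
  obtain ⟨i1, i2⟩ := integrable_of_integrable_pow_four hm h4
  set k := √κ with hk'
  have hk0 : 0 < k := Real.sqrt_pos.2 hκ
  have hk2 : κ = k ^ 2 := (Real.sq_sqrt hκ.le).symm
  set s := ∫ x, Y x ^ 2 ∂ν with hs
  have hs0 : 0 ≤ s := integral_nonneg fun x => by positivity
  -- The cubic term 4tY³ is split as (2/k)Y⁴ + 2kt²Y², whose first part turns κ = k² into k² + 2k.
  have hpt : ∀ x, (Y x + t) ^ 4 ≤ (1 + 2 / k) * Y x ^ 4 + (6 + 2 * k) * t ^ 2 * Y x ^ 2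
      + 4 * t ^ 3 * Y x + t ^ 4 := fun x => by
    have h : (1 + 2 / k) * Y x ^ 4 + (6 + 2 * k) * t ^ 2 * Y x ^ 2
      + 4 * t ^ 3 * Y x + t ^ 4 - (Y x + t) ^ 4 = 2 / k * (Y x ^ 2 - k * t * Y x) ^ 2 := by
      field_simp; ring
    have : 0 ≤ 2 / k * (Y x ^ 2 - k * t * Y x) ^ 2 := by positivity
    linarith
  have j1 : Integrable (fun x => (1 + 2 / k) * Y x ^ 4 + (6 + 2 * k) * t ^ 2 * Y x ^ 2) ν :=
    (h4.const_mul _).add (i2.const_mul _)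
  have j2 : Integrable (fun x => (1 + 2 / k) * Y x ^ 4 + (6 + 2 * k) * t ^ 2 * Y x ^ 2
      + 4 * t ^ 3 * Y x) ν := j1.add (i1.const_mul _)
  have j3 : Integrable (fun x => (1 + 2 / k) * Y x ^ 4 + (6 + 2 * k) * t ^ 2 * Y x ^ 2
      + 4 * t ^ 3 * Y x + t ^ 4) ν := j2.add (integrable_const _)
  have hi : Integrable (fun x => (Y x + t) ^ 4) ν :=
    j3.mono' (by fun_prop) (Filter.Eventually.of_forall fun x => by
      rw [Real.norm_eq_abs, abs_of_nonneg (by positivity)]; exact hpt x)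
  refine ⟨hi, (integral_mono hi j3 hpt).trans ?_⟩
  rw [integral_add j2 (integrable_const _), integral_add j1 (i1.const_mul _),
    integral_add (h4.const_mul _) (i2.const_mul _)]
  simp only [integral_const_mul, integral_const, probReal_univ, one_smul, h1, ← hs]
  -- Nonnegativity of the variance of Y² forces κ ≥ 1 unless Y has zero variance.
  have hcs : s ^ 2 ≤ κ * s ^ 2 := by
    refine le_trans ?_ hk
    have h0 : 0 ≤ ∫ x, (Y x ^ 2 - s) ^ 2 ∂ν := integral_nonneg fun x => by positivity
    have e : ∀ x, (Y x ^ 2 - s) ^ 2 = Y x ^ 4 - 2 * s * Y x ^ 2 + s ^ 2 := fun x => by ring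
    simp_rw [e] at h0
    rw [integral_add (f := fun x => Y x ^ 4 - 2 * s * Y x ^ 2) (h4.sub (i2.const_mul _))
      (integrable_const _), integral_sub h4 (i2.const_mul _), integral_const_mul] at h0
    simp only [integral_const, probReal_univ, one_smul, ← hs] at h0
    nlinarith
  have hb : (1 + 2 / k) * ∫ x, Y x ^ 4 ∂ν ≤ (k ^ 2 + 2 * k) * s ^ 2 := by
    refine (mul_le_mul_of_nonneg_left hk (by positivity)).trans (le_of_eq ?_)
    rw [hk2]; field_simp
  have hc : (6 + 2 * k) * t ^ 2 * s ≤ 2 * (k + 1) ^ 2 * t ^ 2 * s := by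
    rcases hs0.eq_or_lt with h | h
    · rw [← h]; simp
    · have : 1 ≤ k := by
        by_contra hlt
        push Not at hlt
        have : κ < 1 := by rw [hk2]; nlinarith
        nlinarith [pow_pos h 2]
      have h3 : 6 + 2 * k ≤ 2 * (k + 1) ^ 2 := by nlinarith
      gcongr
  nlinarith [sq_nonneg s, sq_nonneg (t ^ 2), mul_nonneg hk0.le (sq_nonneg (t ^ 2)),
    mul_nonneg (sq_nonneg k) (sq_nonneg (t ^ 2))]

end Kurtosis

/-! ### Whitening with one extra coordinate, degenerate covariances included. -/

section Whitening

variable {d : ℕ} {ν : Measure (EuclideanSpace ℝ (Fin d))} {κ : ℝ}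

/-- The covariance bilinear form. -/
noncomputable def covForm (ν : Measure (EuclideanSpace ℝ (Fin d))) (m : EuclideanSpace ℝ (Fin d))
    (h : ∀ θ : EuclideanSpace ℝ (Fin d), Integrable (fun x => inner ℝ θ (x - m) ^ 2) ν) :
    LinearMap.BilinForm ℝ (EuclideanSpace ℝ (Fin d)) :=
  have hi : ∀ θ θ' : EuclideanSpace ℝ (Fin d),
      Integrable (fun x => inner ℝ θ (x - m) * inner ℝ θ' (x - m)) ν := fun θ θ' => by
    refine Integrable.mono' ((h θ).add (h θ')) (by fun_prop)
      (Filter.Eventually.of_forall fun x => ?_)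
    simp only [Real.norm_eq_abs, Pi.add_apply]
    rw [abs_le]
    constructor <;> nlinarith [sq_nonneg (inner ℝ θ (x - m) + inner ℝ θ' (x - m)),
      sq_nonneg (inner ℝ θ (x - m) - inner ℝ θ' (x - m))]
  LinearMap.mk₂ ℝ (fun θ θ' => ∫ x, inner ℝ θ (x - m) * inner ℝ θ' (x - m) ∂ν)
    (fun θ₁ θ₂ θ' => by
      simp_rw [inner_add_left, add_mul]; exact integral_add (hi _ _) (hi _ _))
    (fun c θ θ' => by
      simp_rw [real_inner_smul_left, mul_assoc]; rw [integral_const_mul, smul_eq_mul])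
    (fun θ θ₁ θ₂ => by
      simp_rw [inner_add_left, mul_add]; exact integral_add (hi _ _) (hi _ _))
    (fun c θ θ' => by
      simp_rw [real_inner_smul_left, mul_left_comm _ c]; rw [integral_const_mul, smul_eq_mul])

lemma covForm_apply_self (m : EuclideanSpace ℝ (Fin d))
    (h : ∀ θ : EuclideanSpace ℝ (Fin d), Integrable (fun x => inner ℝ θ (x - m) ^ 2) ν)
    (θ : EuclideanSpace ℝ (Fin d)) :
    covForm ν m h θ θ = ∫ x, inner ℝ θ (x - m) ^ 2 ∂ν := by
  simp_rw [sq]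
  rfl

lemma covForm_isSymm (m : EuclideanSpace ℝ (Fin d))
    (h : ∀ θ : EuclideanSpace ℝ (Fin d), Integrable (fun x => inner ℝ θ (x - m) ^ 2) ν) :
    LinearMap.IsSymm (covForm ν m h) :=
  ⟨fun x y => by
    change ∫ _, _ ∂ν = ∫ _, _ ∂ν
    simp_rw [mul_comm]⟩

/-- Whitened coordinates, with one more coordinate for the unknown mean. -/
theorem exists_whitening [IsProbabilityMeasure ν] (hX : Integrable (fun x => x) ν) (hκ : 0 < κ)
    (h : KurtosisLE ν (fun x => x) κ) :
    ∃ (ι : Type) (_ : Fintype ι) (Z : EuclideanSpace ℝ (Fin d) → EuclideanSpace ℝ ι)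
      (T : EuclideanSpace ℝ (Fin d) → ℝ → EuclideanSpace ℝ ι) (S : Set (EuclideanSpace ℝ (Fin d))),
      Fintype.card ι = d + 1 ∧ Measurable Z ∧ MeasurableSet S ∧ ν Sᶜ = 0 ∧
      (∀ v, Integrable (fun x => inner ℝ v (Z x) ^ 4) ν ∧
        ∫ x, inner ℝ v (Z x) ^ 4 ∂ν ≤ (√κ + 1) ^ 2 * ‖v‖ ^ 4) ∧
      ∀ θ ξ, ‖T θ ξ‖ ^ 2 = dirVar ν (fun x => x) θ + (inner ℝ θ (∫ x, x ∂ν) - ξ) ^ 2 ∧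
        ∫ x, inner ℝ (T θ ξ) (Z x) ^ 2 ∂ν = ‖T θ ξ‖ ^ 2 ∧
        ∀ x ∈ S, inner ℝ (T θ ξ) (Z x) = inner ℝ θ x - ξ := by
  classical
  set m := ∫ x, x ∂ν with hm
  have hi : ∀ θ : EuclideanSpace ℝ (Fin d), Integrable (fun x => inner ℝ θ (x - m)) ν ∧
      Integrable (fun x => inner ℝ θ (x - m) ^ 2) ν := fun θ =>
    integrable_of_integrable_pow_four (by fun_prop) (h θ).1
  have hmean : ∀ θ : EuclideanSpace ℝ (Fin d), ∫ x, inner ℝ θ (x - m) ∂ν = 0 := fun θ => by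
    have := integral_inner (𝕜 := ℝ) (hX.sub (integrable_const m)) θ
    simp only [Pi.sub_apply] at this
    rw [this, integral_sub hX (integrable_const m), ← hm]
    simp
  set B := covForm ν m fun θ => (hi θ).2 with hB
  have hBself : ∀ θ, B θ θ = dirVar ν (fun x => x) θ := fun θ => covForm_apply_self _ _ _
  obtain ⟨e, he⟩ := LinearMap.BilinForm.exists_orthogonal_basis
    (covForm_isSymm m fun θ => (hi θ).2)
  set s : Fin (Module.finrank ℝ (EuclideanSpace ℝ (Fin d))) → ℝ := fun j => B (e j) (e j) with hs
  have hs0 : ∀ j, 0 ≤ s j := fun j => by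
    rw [hs]; simp only [hBself]; exact integral_nonneg fun x => by positivity
  have hvar : ∀ c : Fin (Module.finrank ℝ (EuclideanSpace ℝ (Fin d))) → ℝ,
      dirVar ν (fun x => x) (∑ j, c j • e j) = ∑ j, c j ^ 2 * s j := fun c => by
    rw [← hBself]
    simp only [map_sum, LinearMap.sum_apply, map_smul, LinearMap.smul_apply, smul_eq_mul]
    refine Finset.sum_congr rfl fun i _ => ?_
    rw [Finset.sum_eq_single i]
    · ring
    · intro j _ hj
      have : B (e j) (e i) = 0 := he hj
      rw [this]; simp
    · simp
  -- Where s j = 0, the convention x / 0 = 0 makes the coordinate vanish, so no invertibility is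
  -- needed.
  set Z : EuclideanSpace ℝ (Fin d) →
      EuclideanSpace ℝ (Option (Fin (Module.finrank ℝ (EuclideanSpace ℝ (Fin d))))) := fun x =>
    WithLp.toLp 2 fun o => o.elim 1 fun j => inner ℝ (e j) (x - m) / √(s j) with hZ
  have hZinner : ∀ v x, inner ℝ v (Z x)
      = inner ℝ (∑ j, (v (some j) / √(s j)) • e j) (x - m) + v none := fun v x => by
    rw [PiLp.inner_apply, Fintype.sum_option, sum_inner, add_comm]
    simp only [hZ, Option.elim, real_inner_smul_left, RCLike.inner_apply, conj_trivial, one_mul]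
    congr 1
    exact Finset.sum_congr rfl fun j _ => by ring
  -- Only an inequality, since degenerate coordinates of v are lost. Equality of second moments is
  -- proved below only for vectors of the form T θ ξ.
  have hvarle : ∀ v : EuclideanSpace ℝ (Option (Fin (Module.finrank ℝ (EuclideanSpace ℝ (Fin d))))),
      dirVar ν (fun x => x) (∑ j, (v (some j) / √(s j)) • e j) + v none ^ 2 ≤ ‖v‖ ^ 2 := fun v => by
    rw [hvar, EuclideanSpace.real_norm_sq_eq, Fintype.sum_option, add_comm]
    gcongr with j
    rcases (hs0 j).eq_or_lt with h0 | h0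
    · rw [← h0]; simp; positivity
    · rw [div_pow, Real.sq_sqrt h0.le, div_mul_cancel₀ _ h0.ne']
  have hdir0 : ∀ θ, 0 ≤ dirVar ν (fun x => x) θ := fun θ => integral_nonneg fun x => by positivity
  -- Off a null set, degenerate directions of the centred observation vanish, so ⟨T θ ξ, Z x⟩
  -- recovers ⟨θ, x⟩ - ξ exactly.
  set S : Set (EuclideanSpace ℝ (Fin d)) := {x | ∀ j, s j = 0 → inner ℝ (e j) (x - m) = 0} with hS
  have hSm : MeasurableSet S := by
    rw [hS, Set.ofPred_forall]
    refine MeasurableSet.iInter fun j => ?_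
    by_cases h0 : s j = 0
    · simp only [h0, true_implies]
      exact measurableSet_eq_fun (by fun_prop) measurable_const
    · simp [h0]
  have hSae : ∀ᵐ x ∂ν, x ∈ S := by
    rw [hS]
    simp only [Set.mem_ofPred_eq]
    rw [ae_all_iff]
    intro j
    by_cases h0 : s j = 0
    · have h1 : ∫ x, inner ℝ (e j) (x - m) ^ 2 ∂ν = 0 := by
        rw [← h0]; exact (hBself (e j)).symm
      rw [integral_eq_zero_iff_of_nonneg (fun x => by positivity) (hi (e j)).2] at h1
      filter_upwards [h1] with x hx _
      simpa using hx
    · exact Filter.Eventually.of_forall fun x hx => absurd hx h0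
  set T : EuclideanSpace ℝ (Fin d) → ℝ →
      EuclideanSpace ℝ (Option (Fin (Module.finrank ℝ (EuclideanSpace ℝ (Fin d))))) := fun θ ξ =>
    WithLp.toLp 2 fun o => o.elim (inner ℝ θ m - ξ) fun j => e.repr θ j * √(s j) with hT
  have hTnorm : ∀ θ ξ, ‖T θ ξ‖ ^ 2 = dirVar ν (fun x => x) θ + (inner ℝ θ m - ξ) ^ 2 :=
    fun θ ξ => by
      rw [EuclideanSpace.real_norm_sq_eq, Fintype.sum_option, add_comm]
      conv_rhs => rw [← e.sum_repr θ, hvar, e.sum_repr θ]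
      simp only [hT, Option.elim]
      congr 1
      exact Finset.sum_congr rfl fun j _ => by rw [mul_pow, Real.sq_sqrt (hs0 j)]
  have hTZ : ∀ θ ξ, ∀ x ∈ S, inner ℝ (T θ ξ) (Z x) = inner ℝ θ (x - m) + (inner ℝ θ m - ξ) :=
    fun θ ξ x hx => by
      rw [hZinner]
      conv_rhs => rw [← e.sum_repr θ]
      rw [e.sum_repr θ]
      simp only [hT, Option.elim]
      congr 1
      conv_rhs => rw [← e.sum_repr θ]
      rw [sum_inner, sum_inner]
      refine Finset.sum_congr rfl fun j _ => ?_
      rw [real_inner_smul_left, real_inner_smul_left]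
      rcases (hs0 j).eq_or_lt with h0 | h0
      · rw [hx j h0.symm]; simp
      · rw [mul_div_cancel_right₀ _ (Real.sqrt_pos.2 h0).ne']
  refine ⟨_, inferInstance, Z, T, S, ?_, ?_, hSm, hSae, ?_, fun θ ξ => ⟨hTnorm θ ξ, ?_, ?_⟩⟩
  · simp
  · refine (WithLp.measurable_toLp 2 _).comp (measurable_pi_lambda _ fun o => ?_)
    cases o with
    | none => exact measurable_const
    | some j =>
      simp only [Option.elim]
      fun_prop
  · intro v
    simp_rw [hZinner]
    have := integral_add_const_pow_four_le hκ (by fun_prop) (h _).1 (hmean _) (h _).2 (v none)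
      (Y := fun x => inner ℝ (∑ j, (v (some j) / √(s j)) • e j) (x - m))
    refine ⟨this.1, this.2.trans ?_⟩
    rw [show ‖v‖ ^ 4 = (‖v‖ ^ 2) ^ 2 by ring]
    refine mul_le_mul_of_nonneg_left (pow_le_pow_left₀ ?_ (hvarle v) 2) (by positivity)
    exact add_nonneg (hdir0 _) (sq_nonneg _)
  · rw [hTnorm]
    have h1 : ∫ x, inner ℝ (T θ ξ) (Z x) ^ 2 ∂ν
        = ∫ x, (inner ℝ θ (x - m) ^ 2 + 2 * (inner ℝ θ m - ξ) * inner ℝ θ (x - m)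
          + (inner ℝ θ m - ξ) ^ 2) ∂ν := by
      refine integral_congr_ae ?_
      filter_upwards [hSae] with x hx
      rw [hTZ θ ξ x hx]; ring
    have j1 : Integrable (fun x => inner ℝ θ (x - m) ^ 2
        + 2 * (inner ℝ θ m - ξ) * inner ℝ θ (x - m)) ν := (hi θ).2.add ((hi θ).1.const_mul _)
    rw [h1, integral_add j1 (integrable_const _), integral_add (hi θ).2 ((hi θ).1.const_mul _),
      integral_const_mul, hmean]
    simp [dirVar, ← hm]
  · intro x hx
    rw [hTZ θ ξ x hx, inner_sub_right]; ring

end Whitening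

end RobustCov

namespace RobustCov

/-! ### From signs of the criterion to bounds on the estimate. -/

section Estimate

variable {d n : ℕ} {lam : ℝ} {y : Fin n → EuclideanSpace ℝ (Fin d)}
  {θ : EuclideanSpace ℝ (Fin d)}

lemma bddBelow_robustEnergy_set (ξ : ℝ) : BddBelow {ρ : ℝ | 0 < ρ ∧
    ∑ i, psi (lam * ((inner ℝ θ (y i) - ξ) ^ 2 / ρ - 1)) ≤ 0} :=
  ⟨0, fun _ h => h.1.le⟩

lemma robustEnergy_nonneg (ξ : ℝ) : 0 ≤ robustEnergy lam y θ ξ :=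
  Real.sInf_nonneg fun _ h => h.1.le

lemma robustEnergy_set_nonempty (hl : 0 ≤ lam) (ξ : ℝ) : {ρ : ℝ | 0 < ρ ∧
    ∑ i, psi (lam * ((inner ℝ θ (y i) - ξ) ^ 2 / ρ - 1)) ≤ 0}.Nonempty := by
  have hs : 0 < 1 + ∑ i, (inner ℝ θ (y i) - ξ) ^ 2 := by
    have := Finset.sum_nonneg fun i (_ : i ∈ Finset.univ) => sq_nonneg (inner ℝ θ (y i) - ξ)
    linarith
  refine ⟨1 + ∑ i, (inner ℝ θ (y i) - ξ) ^ 2, hs, Finset.sum_nonpos fun i _ => ?_⟩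
  rw [← psi_zero]
  refine psi_monotone (mul_nonpos_of_nonneg_of_nonpos hl ?_)
  rw [sub_nonpos, div_le_one hs]
  have := Finset.single_le_sum (f := fun i => (inner ℝ θ (y i) - ξ) ^ 2)
    (fun i _ => sq_nonneg _) (Finset.mem_univ i)
  linarith

lemma covEstimate_le_of_sum_nonpos {ρ : ℝ} (hρ : 0 < ρ) (ξ : ℝ)
    (h : ∑ i, psi (lam * ((inner ℝ θ (y i) - ξ) ^ 2 / ρ - 1)) ≤ 0) :
    covEstimate lam y θ ≤ ρ :=
  (ciInf_le ⟨0, by rintro _ ⟨ξ, rfl⟩; exact robustEnergy_nonneg ξ⟩ ξ).trans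
    (csInf_le (bddBelow_robustEnergy_set ξ) ⟨hρ, h⟩)

/-- The criterion is nonincreasing in ρ > 0, so being positive at ρ₀ excludes every smaller level.
-/
lemma le_robustEnergy_of_sum_pos (hl : 0 ≤ lam) {ρ₀ : ℝ} (ξ : ℝ)
    (h : 0 < ∑ i, psi (lam * ((inner ℝ θ (y i) - ξ) ^ 2 / ρ₀ - 1))) :
    ρ₀ ≤ robustEnergy lam y θ ξ := by
  refine le_csInf (robustEnergy_set_nonempty hl ξ) fun ρ hρ => ?_
  by_contra hlt
  push Not at hlt
  refine absurd hρ.2 (not_le.2 (h.trans_le (Finset.sum_le_sum fun i _ => ?_)))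
  refine psi_monotone (mul_le_mul_of_nonneg_left (sub_le_sub_right ?_ 1) hl)
  exact div_le_div_of_nonneg_left (sq_nonneg _) hρ.1 hlt.le

lemma abs_ratio_sub_one_le {V δ m : ℝ} (hV : 0 ≤ V) (hl : 0 ≤ lam) (hδ : 0 < δ)
    (h0 : V = 0 → ∀ i, inner ℝ θ (y i) = m)
    (hU : 0 < V → δ < 1 → ∑ i, psi (lam * ((inner ℝ θ (y i) - m) ^ 2 / (V / (1 - δ)) - 1)) ≤ 0)
    (hL : 0 < V → ∀ ξ, 0 < ∑ i, psi (lam * ((inner ℝ θ (y i) - ξ) ^ 2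
      / ((V + (m - ξ) ^ 2) / (1 + δ)) - 1))) :
    (((ratio V (covEstimate lam y θ) - 1).abs : ENNReal) : EReal) ≤ (δ : EReal) := by
  have hreal : ∀ r : ℝ, |r - 1| ≤ δ → ((((r : EReal) - 1).abs : ENNReal) : EReal) ≤ (δ : EReal) := by
    intro r hr
    rw [← EReal.coe_one, ← EReal.coe_sub, EReal.abs_def, EReal.coe_ennreal_ofReal,
      max_eq_left (abs_nonneg _)]
    exact_mod_cast hr
  rcases hV.eq_or_lt with hV0 | hV0
  -- With zero variance all terms at ξ = m equal ψ(-λ) ≤ 0, so every ρ > 0 is admissible and the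
  -- convention 0/0 = 1 applies.
  · have hcov : covEstimate lam y θ = 0 := by
      refine le_antisymm (le_of_forall_pos_le_add fun ρ hρ => ?_)
        (Real.iInf_nonneg fun ξ => robustEnergy_nonneg ξ)
      rw [zero_add]
      refine covEstimate_le_of_sum_nonpos hρ m (Finset.sum_nonpos fun i _ => ?_)
      rw [h0 hV0.symm i, ← psi_zero]
      exact psi_monotone (by simpa using hl)
    rw [ratio, hcov, if_pos rfl, if_pos hV0.symm]
    have := hreal 1 (by simpa using hδ.le)
    simpa using this
  · have hlow : V / (1 + δ) ≤ covEstimate lam y θ := by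
      refine le_ciInf fun ξ => le_trans ?_ (le_robustEnergy_of_sum_pos hl ξ (hL hV0 ξ))
      gcongr
      linarith [sq_nonneg (m - ξ)]
    have hpos : 0 < covEstimate lam y θ := lt_of_lt_of_le (by positivity) hlow
    rw [ratio, if_neg hpos.ne']
    refine hreal _ (abs_le.2 ⟨?_, ?_⟩)
    · rcases lt_or_ge δ 1 with h1 | h1
      · have hup := covEstimate_le_of_sum_nonpos (div_pos hV0 (by linarith)) m (hU hV0 h1)
        rw [le_div_iff₀ (by linarith)] at hup
        have : 1 - δ ≤ V / covEstimate lam y θ := by rw [le_div_iff₀ hpos]; linarith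
        linarith
      -- For δ ≥ 1 the lower bound 1 - δ on the ratio is trivial.
      · have : 0 ≤ V / covEstimate lam y θ := by positivity
        linarith
    · have : V / covEstimate lam y θ ≤ 1 + δ := by
        rw [div_le_iff₀ (by linarith)] at hlow
        rw [div_le_iff₀ hpos]; linarith
      linarith

end Estimate

/-! ### Arithmetic of λ, μ and the sample size. -/

section Parameters

lemma deviation_upper {lam q u μ δ : ℝ} (hl : 0 < lam) (hu : 0 ≤ u) (hq : 0 < q)
    (hμ : q * lam + 6.75 * u ≤ μ) (h12 : (q * lam + lam) / 2 < 1 - 2 * μ)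
    (hδ : δ * (1 - 2 * μ) = μ) (hδ1 : δ < 1) :
    (lam * (1 - δ) - lam) + ((q + 1) * (lam * (1 - δ)) ^ 2 - 2 * lam * (lam * (1 - δ)) + lam ^ 2) / 2
      + 6.75 * (lam * (1 - δ)) * u + q * lam ^ 2 / 2 ≤ 0 := by
  have hql := mul_pos hq hl
  have hμ0 : 0 < μ := by linarith
  have hδ0 : 0 < δ := by
    by_contra h
    push Not at h
    nlinarith
  have e : (lam * (1 - δ) - lam) + ((q + 1) * (lam * (1 - δ)) ^ 2
      - 2 * lam * (lam * (1 - δ)) + lam ^ 2) / 2 + 6.75 * (lam * (1 - δ)) * u + q * lam ^ 2 / 2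
      = lam * ((q * lam + 6.75 * u) * (1 - δ) + δ * (δ * ((q * lam + lam) / 2)) - δ) := by ring
  rw [e]
  -- The bracket is at most μ(1 - δ) + δμ - δ = -2μδ.
  refine mul_nonpos_of_nonneg_of_nonpos hl.le ?_
  have h1 : (q * lam + 6.75 * u) * (1 - δ) ≤ μ * (1 - δ) :=
    mul_le_mul_of_nonneg_right hμ (by linarith)
  have h2 : δ * (δ * ((q * lam + lam) / 2)) ≤ δ * μ :=
    mul_le_mul_of_nonneg_left ((mul_le_mul_of_nonneg_left h12.le hδ0.le).trans hδ.le) hδ0.le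
  nlinarith [mul_pos hμ0 hδ0]

lemma deviation_lower {lam q u μ δ : ℝ} (hl : 0 < lam) (hu : 0 ≤ u) (hq : 0 < q)
    (hμ : q * lam + 6.75 * u ≤ μ) (h12 : (q * lam + lam) / 2 < 1 - 2 * μ)
    (hδ : δ * (1 - 2 * μ) = μ) :
    -1 * (lam * (1 + δ) - lam)
      + ((q + 1) * (lam * (1 + δ)) ^ 2 - 2 * lam * (lam * (1 + δ)) + lam ^ 2) / 2
      + 6.75 * (lam * (1 + δ)) * u + q * lam ^ 2 / 2 < 0 := by
  have hql := mul_pos hq hl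
  have hμ0 : 0 < μ := by linarith
  have hδ0 : 0 < δ := by
    by_contra h
    push Not at h
    nlinarith
  have e : -1 * (lam * (1 + δ) - lam) + ((q + 1) * (lam * (1 + δ)) ^ 2
      - 2 * lam * (lam * (1 + δ)) + lam ^ 2) / 2 + 6.75 * (lam * (1 + δ)) * u + q * lam ^ 2 / 2
      = lam * ((q * lam + 6.75 * u) * (1 + δ) + δ * (δ * ((q * lam + lam) / 2)) - δ) := by ring
  rw [e]
  -- The bracket is strictly below μ(1 + δ) + δμ - δ = 0: this identity is what determines δ = μ/(1
  -- - 2μ).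
  refine mul_neg_of_pos_of_neg hl ?_
  have h1 : (q * lam + 6.75 * u) * (1 + δ) ≤ μ * (1 + δ) :=
    mul_le_mul_of_nonneg_right hμ (by linarith)
  have h2 : δ * (δ * ((q * lam + lam) / 2)) < δ * μ :=
    mul_lt_mul_of_pos_left ((mul_lt_mul_of_pos_left h12 hδ0).trans_le hδ.le) hδ0
  nlinarith

/-- Consequences of the sample size condition for the scale `lam`, the deviation `dev`, and
`u = (√κ + 1) √((d + 1) / n)`. -/
lemma parameters {d n : ℕ} {κ ε : ℝ} (hκ : 0 < κ) (hε : 0 < ε) (hε2 : ε < 1)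
    (hn : threshold d κ ε < n) :
    ∃ u : ℝ, 0 < u ∧ (0 : ℝ) < n ∧ 0 < scale d n κ ε ∧
      u ^ 2 = (√κ + 1) ^ 2 * (d + 1) / n ∧
      (κ + 2 * √κ) * scale d n κ ε ^ 2 / 2 = (Real.log ε⁻¹ + 0.73 * (d + 1)) / n ∧
      dev d n κ ε = (κ + 2 * √κ) * scale d n κ ε + 6.81 * √2 * u ∧
      20 * u + 5 / 2 * ((κ + 2 * √κ) * scale d n κ ε) + scale d n κ ε / 2 < 1 := by
  have hΛ : 0 < Real.log ε⁻¹ := Real.log_pos (one_lt_inv₀ hε |>.2 hε2)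
  have hn0 : (0 : ℝ) < n := (sq_nonneg _).trans_lt hn
  have hk0 : 0 < √κ := Real.sqrt_pos.2 hκ
  set k := √κ
  set q := κ + 2 * k with hq
  have hq0 : 0 < q := by positivity
  set L := Real.log ε⁻¹ + 0.73 * ((d : ℝ) + 1) with hL
  have hL0 : 0 < L := by positivity
  have hsn : 0 < √(n : ℝ) := Real.sqrt_pos.2 hn0
  have hsc : scale d n κ ε = √(2 / (q * n) * L) := rfl
  have hm : √(2 * q / n * L) = q * √(2 / (q * n) * L) := by
    rw [show 2 * q / n * L = q ^ 2 * (2 / (q * n) * L) by field_simp,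
      Real.sqrt_mul (by positivity), Real.sqrt_sq hq0.le]
  have hm2 : √(2 * q / n * L) = √(2 * q * L) / √n := by
    rw [← Real.sqrt_div (by positivity)]; congr 1; ring
  refine ⟨(k + 1) * √((d + 1) / n), by positivity, hn0, ?_, ?_, ?_, ?_, ?_⟩
  · rw [hsc]; positivity
  · rw [mul_pow, Real.sq_sqrt (by positivity)]; ring
  · rw [hsc, Real.sq_sqrt (by positivity)]; field_simp
  · rw [hsc, ← hm]
    change √(2 * q / n * L) + 6.81 * (k + 1) * √(2 * (d + 1) / n) = _
    rw [show 2 * ((d : ℝ) + 1) / n = 2 * ((d + 1) / n) by ring,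
      Real.sqrt_mul (by norm_num : (0 : ℝ) ≤ 2) ((d + 1) / n)]
    ring
  · have h1 : 20 * (k + 1) * √(d + 1) + (5 / 2 + 1 / (2 * q)) * √(2 * q * L) < √n := by
      rw [Real.lt_sqrt (by positivity)]
      exact hn
    rw [← div_lt_one hsn] at h1
    refine lt_of_eq_of_lt ?_ h1
    have h2 : √(2 / (q * n) * L) = √(2 * q * L) / √n / q := by
      rw [← hm2, hm, mul_div_cancel_left₀ _ hq0.ne']
    rw [hsc, h2, Real.sqrt_div (by positivity)]
    field_simp
    ring

end Parameters

end RobustCov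

/-! ### Assembly of the deviation bound and its order of magnitude. -/

namespace RobustCov

/-- Inserts b² = 1/(8nu). The smoothing term gives 2.75su and the entropy 4su, together 6.75su. The
remaining term contributes 41D/64 ≤ 0.73D, which with Λ is exactly nql²/2. -/
lemma deviation_bound_le {n b K D s l σ Λ q u : ℝ} (hn : 0 < n) (hu : 0 < u) (hD : 0 ≤ D)
    (hb : b ^ 2 = (8 * n * u)⁻¹) (hK : K = q + 1) (hu2 : u ^ 2 = K * D / n)
    (hl : q * l ^ 2 / 2 = (Λ + 0.73 * D) / n) :
    n * (σ * (s - l) + (K * s ^ 2 - 2 * l * s + l ^ 2) / 2 + 22 * b ^ 2 * (K * s * D)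
        + 41 * b ^ 4 * (K * D ^ 2)) + s / (2 * b ^ 2) + Λ
      ≤ n * (σ * (s - l) + ((q + 1) * s ^ 2 - 2 * l * s + l ^ 2) / 2 + 6.75 * s * u
        + q * l ^ 2 / 2) := by
  have hKD : K * D = n * u ^ 2 := by rw [hu2]; field_simp
  have h1 : 22 * b ^ 2 * (K * s * D) = 2.75 * s * u := by
    rw [hb, show K * s * D = s * (K * D) by ring, hKD]; field_simp; ring
  have h2 : 41 * b ^ 4 * (K * D ^ 2) = 41 / 64 * D / n := by
    rw [show b ^ 4 = (b ^ 2) ^ 2 by ring, hb, show K * D ^ 2 = D * (K * D) by ring, hKD]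
    field_simp; ring
  have h3 : s / (2 * b ^ 2) = n * (4 * s * u) := by
    rw [hb]; field_simp; ring
  have h4 : n * (41 / 64 * D / n) = 41 / 64 * D := by field_simp
  have h5 : n * ((Λ + 0.73 * D) / n) = Λ + 0.73 * D := by field_simp
  rw [h1, h2, h3, hl, ← hK]
  nlinarith

lemma exists_measurableSet_of_map {Ω α : Type*} [MeasurableSpace Ω] [MeasurableSpace α]
    {P : Measure Ω} [IsProbabilityMeasure P] {f : Ω → α} (hf : AEMeasurable f P) {G : Set α}
    (hG : MeasurableSet G) {δ : ℝ} (hδ : 0 ≤ δ) (h : P.map f Gᶜ ≤ ENNReal.ofReal δ) :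
    ∃ B : Set Ω, MeasurableSet B ∧ 1 - δ ≤ P.real B ∧ ∀ ω ∈ B, f ω ∈ G := by
  -- The sample map is only almost everywhere measurable, so the preimage of G is replaced by a
  -- measurable subset of equal measure.
  obtain ⟨B, hBG, hB, hae⟩ := (hf.nullMeasurable hG).exists_measurable_subset_ae_eq
  refine ⟨B, hB, ?_, fun ω hω => hBG hω⟩
  have hc : P Bᶜ ≤ ENNReal.ofReal δ := by
    rw [measure_congr hae.compl, ← Set.preimage_compl, ← Measure.map_apply_of_aemeasurable hf hG.compl]
    exact h
  have h1 : P.real Bᶜ ≤ δ := ENNReal.toReal_le_of_le_ofReal hδ hc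
  have h2 := probReal_compl_eq_one_sub (μ := P) hB
  linarith

/-- The deviation bound for the sample law, given as a product measure. -/
theorem exists_event_ratio_le {d n : ℕ} (ν : Measure (EuclideanSpace ℝ (Fin d)))
    [IsProbabilityMeasure ν] {κ ε : ℝ} (hX : Integrable (fun x => x) ν) (hκ : 0 < κ)
    (h : KurtosisLE ν (fun x => x) κ) (hε : 0 < ε) (hε2 : ε < 1)
    (hn : threshold d κ ε < (n : ℝ)) :
    ∃ G : Set (Fin n → EuclideanSpace ℝ (Fin d)), MeasurableSet G ∧
      (Measure.pi fun _ : Fin n => ν) Gᶜ ≤ ENNReal.ofReal (2 * ε) ∧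
      ∀ x ∈ G, ∀ θ : EuclideanSpace ℝ (Fin d),
        (((ratio (dirVar ν (fun x => x) θ) (covEstimate (scale d n κ ε) x θ) - 1).abs : ENNReal)
          : EReal) ≤ ((dev d n κ ε / (1 - 2 * dev d n κ ε) : ℝ) : EReal) := by
  obtain ⟨u, hu, hn0, hl, hu2, hl2, hdev, h20⟩ := parameters hκ hε hε2 hn
  obtain ⟨ι, hι, Z, T, S, hcard, hZ, hS, hSν, hK4, hT⟩ := exists_whitening hX hκ h
  set lam := scale d n κ ε
  set μ := dev d n κ ε
  set q := κ + 2 * √κ with hq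
  have hk0 : 0 < √κ := Real.sqrt_pos.2 hκ
  have hq0 : 0 < q := by positivity
  have hKq : (√κ + 1) ^ 2 = q + 1 := by
    rw [hq]; nlinarith [Real.sq_sqrt hκ.le]
  have hs2 : 1 ≤ √2 := Real.one_le_sqrt.2 (by norm_num)
  have hs2' : √2 ≤ 1.4143 := Real.sqrt_le_iff.2 (by norm_num)
  have hμ : q * lam + 6.75 * u ≤ μ := by rw [hdev]; nlinarith
  -- Here 2 · 6.81 · √2 < 20 and 1/2 + 2 = 5/2 match the coefficients in `h20`.
  have h12 : (q * lam + lam) / 2 < 1 - 2 * μ := by rw [hdev]; nlinarith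
  have hql : 0 < q * lam := mul_pos hq0 hl
  have hμ0 : 0 < μ := by linarith
  have h12' : 0 < 1 - 2 * μ := by linarith
  set δ := μ / (1 - 2 * μ) with hδdef
  have hδ : δ * (1 - 2 * μ) = μ := div_mul_cancel₀ _ h12'.ne'
  have hδ0 : 0 < δ := by positivity
  set b := √((8 * n * u)⁻¹) with hb
  have hb0 : 0 < b := by positivity
  have hb2 : b ^ 2 = (8 * n * u)⁻¹ := Real.sq_sqrt (by positivity)
  obtain ⟨G₁, hG₁m, hG₁, hG₁b⟩ := exists_event_sum_psi_le (n := n) (l := lam)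
    (by norm_num : (1 : ℝ) ^ 2 = 1) hb0 hε hZ hK4
  obtain ⟨G₂, hG₂m, hG₂, hG₂b⟩ := exists_event_sum_psi_le (n := n) (l := lam)
    (by norm_num : (-1 : ℝ) ^ 2 = 1) hb0 hε hZ hK4
  have hcard' : (Fintype.card ι : ℝ) = d + 1 := by rw [hcard]; push_cast; ring
  have hG₃ : ∀ᵐ x ∂(Measure.pi fun _ : Fin n => ν), ∀ i, x i ∈ S := by
    rw [ae_all_iff]
    exact fun i => (measurePreserving_eval (fun _ : Fin n => ν) i).quasiMeasurePreserving.ae hSν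
  have hG₃m : MeasurableSet {x : Fin n → EuclideanSpace ℝ (Fin d) | ∀ i, x i ∈ S} := by
    rw [Set.ofPred_forall]
    exact MeasurableSet.iInter fun i => measurable_pi_apply i hS
  refine ⟨G₁ ∩ G₂ ∩ {x | ∀ i, x i ∈ S}, (hG₁m.inter hG₂m).inter hG₃m, ?_, ?_⟩
  · rw [Set.compl_inter, Set.compl_inter]
    refine (measure_union_le _ _).trans ?_
    rw [show (Measure.pi fun _ : Fin n => ν) {x | ∀ i, x i ∈ S}ᶜ = 0 from hG₃, add_zero]
    refine (measure_union_le _ _).trans ((add_le_add hG₁ hG₂).trans ?_)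
    rw [← ENNReal.ofReal_add hε.le hε.le, two_mul]
  · rintro x ⟨⟨hx₁, hx₂⟩, hx₃⟩ θ
    set V := dirVar ν (fun x => x) θ with hVdef
    have hV : 0 ≤ V := integral_nonneg fun x => by positivity
    set m := inner ℝ θ (∫ x, x ∂ν) with hm
    -- Scaling T θ ξ by √(λ/ρ) turns the criterion at (ξ, ρ) into the form of the uniform bound.
    have key : ∀ ξ ρ : ℝ, 0 < ρ → ∃ v : EuclideanSpace ℝ ι,
        ‖v‖ ^ 2 = lam / ρ * (V + (m - ξ) ^ 2) ∧ ∫ x, inner ℝ v (Z x) ^ 2 ∂ν = ‖v‖ ^ 2 ∧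
        ∀ i, inner ℝ v (Z (x i)) ^ 2 - lam = lam * ((inner ℝ θ (x i) - ξ) ^ 2 / ρ - 1) := by
      intro ξ ρ hρ
      obtain ⟨hT1, hT2, hT3⟩ := hT θ ξ
      have hsq : √(lam / ρ) ^ 2 = lam / ρ := Real.sq_sqrt (by positivity)
      have hnorm : ‖√(lam / ρ) • T θ ξ‖ ^ 2 = lam / ρ * ‖T θ ξ‖ ^ 2 := by
        rw [norm_smul, mul_pow, Real.norm_eq_abs, sq_abs, hsq]
      refine ⟨√(lam / ρ) • T θ ξ, by rw [hnorm, hT1], ?_, fun i => ?_⟩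
      · rw [hnorm, ← hT2, ← integral_const_mul]
        congr 1; ext x
        rw [real_inner_smul_left, mul_pow, hsq]
      · rw [real_inner_smul_left, mul_pow, hsq, hT3 _ (hx₃ i)]
        ring
    refine abs_ratio_sub_one_le (m := m) hV hl.le hδ0 ?_ ?_ ?_
    · intro hV0 i
      obtain ⟨hT1, -, hT3⟩ := hT θ m
      rw [← hVdef, hV0, sub_self] at hT1
      have hT0 : T θ m = 0 := by simpa using hT1
      have := hT3 _ (hx₃ i)
      rw [hT0, inner_zero_left] at this
      linarith
    · intro hV0 hδ1
      have hδ1' : 0 < 1 - δ := by linarith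
      obtain ⟨v, hv1, hv2, hv3⟩ := key m (V / (1 - δ)) (div_pos hV0 hδ1')
      have hv1' : ‖v‖ ^ 2 = lam * (1 - δ) := by rw [hv1]; field_simp; ring
      have hbd := hG₁b x hx₁ v hv2
      rw [show ‖v‖ ^ 4 = (‖v‖ ^ 2) ^ 2 by ring, hv1', hcard'] at hbd
      simp only [one_mul, hv3] at hbd
      have h1 := deviation_bound_le (σ := 1) (s := lam * (1 - δ)) hn0 hu
        (by positivity : (0 : ℝ) ≤ d + 1) hb2 hKq hu2 hl2
      have h2 := deviation_upper hl hu.le hq0 hμ h12 hδ hδ1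
      rw [one_mul] at h1
      exact (hbd.trans h1).trans (mul_nonpos_of_nonneg_of_nonpos hn0.le h2)
    · intro hV0 ξ
      have hN : 0 < V + (m - ξ) ^ 2 := by positivity
      obtain ⟨v, hv1, hv2, hv3⟩ := key ξ ((V + (m - ξ) ^ 2) / (1 + δ)) (by positivity)
      have hv1' : ‖v‖ ^ 2 = lam * (1 + δ) := by rw [hv1]; field_simp
      have hbd := hG₂b x hx₂ v hv2
      rw [show ‖v‖ ^ 4 = (‖v‖ ^ 2) ^ 2 by ring, hv1', hcard'] at hbd
      simp only [neg_one_mul, psi_neg, hv3, Finset.sum_neg_distrib] at hbd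
      have h1 := deviation_bound_le (σ := -1) (s := lam * (1 + δ)) hn0 hu
        (by positivity : (0 : ℝ) ≤ d + 1) hb2 hKq hu2 hl2
      have h2 := mul_neg_of_pos_of_neg hn0 (deviation_lower hl hu.le hq0 hμ h12 hδ)
      simp only [neg_one_mul] at h1 h2
      linarith

/-- The order of magnitude of the deviation bound. -/
theorem dev_div_le {d n : ℕ} {κ ε : ℝ} (hκ : 1 ≤ κ) (hε : 0 < ε) (hε2 : ε ≤ 1 / 2)
    (hn : threshold d κ ε < (n : ℝ)) :
    dev d n κ ε / (1 - 2 * dev d n κ ε) ≤ 1000 * √(κ * (d + Real.log ε⁻¹) / n) := by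
  obtain ⟨u, hu, hn0, hl, hu2, hl2, hdev, h20⟩ :=
    parameters (by linarith : 0 < κ) hε (by linarith) hn
  have hΛ : 0.69 ≤ Real.log ε⁻¹ := by
    have h2 : (2 : ℝ) ≤ ε⁻¹ := by
      rw [le_inv_comm₀ (by norm_num) hε]; linarith
    linarith [Real.log_le_log (by norm_num) h2, Real.log_two_gt_d9]
  set Λ := Real.log ε⁻¹
  set lam := scale d n κ ε
  set k := √κ with hk
  have hk2 : k ^ 2 = κ := Real.sq_sqrt (by linarith)
  have hk1 : 1 ≤ k := Real.one_le_sqrt.2 hκ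
  set m := (κ + 2 * k) * lam with hm
  have hm0 : 0 < m := by positivity
  have hd0 : (0 : ℝ) ≤ d := Nat.cast_nonneg d
  set A : ℝ := (d + Λ) / n with hA
  have hA0 : 0 ≤ A := by positivity
  set W := √(κ * (d + Λ) / n) with hW
  have hW0 : 0 ≤ W := Real.sqrt_nonneg _
  have hW2 : W ^ 2 = κ * A := by rw [hW, Real.sq_sqrt (by positivity), hA]; ring
  have hd1 : ((d : ℝ) + 1) / n ≤ 1.5 * A := by
    rw [hA, ← mul_div_assoc]; gcongr; linarith
  have hL : (Λ + 0.73 * ((d : ℝ) + 1)) / n ≤ 2.2 * A := by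
    rw [hA, ← mul_div_assoc]; gcongr; linarith
  have hkκ : κ + 2 * k ≤ 3 * κ := by nlinarith
  have hk4 : (k + 1) ^ 2 ≤ 4 * κ := by nlinarith
  have hu3 : u ≤ 3 * W := by
    refine le_of_sq_le_sq ?_ (by positivity)
    rw [hu2, mul_pow, hW2, mul_div_assoc]
    calc (k + 1) ^ 2 * (((d : ℝ) + 1) / n) ≤ (4 * κ) * (1.5 * A) := by gcongr
      _ ≤ _ := by nlinarith [mul_nonneg (by linarith : 0 ≤ κ) hA0]
  have hm4 : m ≤ 4 * W := by
    refine le_of_sq_le_sq ?_ (by positivity)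
    rw [mul_pow 4 W, hW2]
    have e : m ^ 2 = 2 * (κ + 2 * k) * ((κ + 2 * k) * lam ^ 2 / 2) := by rw [hm]; ring
    rw [e, hl2]
    calc 2 * (κ + 2 * k) * ((Λ + 0.73 * ((d : ℝ) + 1)) / n) ≤ 2 * (3 * κ) * (2.2 * A) := by gcongr
      _ ≤ _ := by nlinarith [mul_nonneg (by linarith : 0 ≤ κ) hA0]
  have hs2' : √2 ≤ 1.4143 := Real.sqrt_le_iff.2 (by norm_num)
  have hdu : dev d n κ ε ≤ m + 9.632 * u := by rw [hdev]; nlinarith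
  -- From 2m + 19.264u ≤ 0.9632(20u + 5m/2) < 0.9632. The numerator is at most 4W + 3 · 9.632W <
  -- 36W, which gives the factor 1000.
  have h1 : 0.036 ≤ 1 - 2 * dev d n κ ε := by linarith
  rw [div_le_iff₀ (by linarith)]
  have : 1000 * W * 0.036 ≤ 1000 * W * (1 - 2 * dev d n κ ε) := by gcongr
  linarith

end RobustCov

theorem proposition3p3 :
    -- the deviation bound; "with probability at least `1 - 2ε`" means that the event contains
    -- a measurable set of at least that probability
    (∀ {d n : ℕ} {Ω Ω' : Type*} [MeasurableSpace Ω] [MeasurableSpace Ω']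
        (P : Measure Ω) [IsProbabilityMeasure P] (P' : Measure Ω') [IsProbabilityMeasure P']
        (X : Ω → EuclideanSpace ℝ (Fin d)) (Xs : Fin n → Ω' → EuclideanSpace ℝ (Fin d))
        (κ ε : ℝ),
        Integrable X P →
        iIndepFun Xs P' →
        (∀ i, IdentDistrib (Xs i) X P' P) →
        0 < κ →
        RobustCov.KurtosisLE P X κ →
        0 < ε →
        RobustCov.threshold d κ ε < (n : ℝ) →
        ∃ B : Set Ω', MeasurableSet B ∧ 1 - 2 * ε ≤ P'.real B ∧
          ∀ ω ∈ B, ∀ θ : EuclideanSpace ℝ (Fin d),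
            (((RobustCov.ratio (RobustCov.dirVar P X θ)
                (RobustCov.covEstimate (RobustCov.scale d n κ ε) (fun i => Xs i ω) θ)
                  - 1).abs : ENNReal) : EReal)
              ≤ ((RobustCov.dev d n κ ε / (1 - 2 * RobustCov.dev d n κ ε) : ℝ) : EReal)) ∧
    -- the order of magnitude of the bound, with a numerical constant
    (∃ C : ℝ, 0 < C ∧ ∀ (d n : ℕ) (κ ε : ℝ), 1 ≤ κ → 0 < ε → ε ≤ 1 / 2 →
        RobustCov.threshold d κ ε < (n : ℝ) →
        RobustCov.dev d n κ ε / (1 - 2 * RobustCov.dev d n κ ε)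
          ≤ C * √(κ * (d + Real.log ε⁻¹) / n)) := by
  refine ⟨?_, 1000, by norm_num, fun d n κ ε hκ hε hε2 hn => RobustCov.dev_div_le hκ hε hε2 hn⟩
  intro d n Ω Ω' _ _ P _ P' _ X Xs κ ε hX hind hid hκ hkurt hε hn
  rcases le_or_gt (1 / 2) ε with hε2 | hε2
  -- For ε ≥ 1/2 the required probability is not positive, so the empty event suffices.
  · exact ⟨∅, .empty, by simp; linarith, by simp⟩
  have hXm : AEMeasurable X P := hX.aestronglyMeasurable.aemeasurable
  have : IsProbabilityMeasure (P.map X) := Measure.isProbabilityMeasure_map hXm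
  have hmean : ∫ x, x ∂(P.map X) = ∫ ω, X ω ∂P := integral_map hXm (by fun_prop)
  have hvar : ∀ θ, RobustCov.dirVar (P.map X) (fun x => x) θ = RobustCov.dirVar P X θ := fun θ => by
    rw [RobustCov.dirVar, RobustCov.dirVar, hmean, integral_map hXm (by fun_prop)]
  have hkurt' : RobustCov.KurtosisLE (P.map X) (fun x => x) κ := fun θ => by
    rw [hvar, hmean, integrable_map_measure (by fun_prop) hXm, integral_map hXm (by fun_prop)]
    exact hkurt θ
  have hXi : Integrable (fun x => x) (P.map X) :=
    (integrable_map_measure (by fun_prop) hXm).2 hX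
  obtain ⟨G, hGm, hG, hGb⟩ :=
    RobustCov.exists_event_ratio_le (P.map X) hXi hκ hkurt' hε (by linarith) hn
  have hXsm : ∀ i, AEMeasurable (Xs i) P' := fun i => (hid i).aemeasurable_fst
  have hlaw : P'.map (fun ω i => Xs i ω) = Measure.pi fun _ => P.map X := by
    rw [(iIndepFun_iff_map_fun_eq_pi_map hXsm).1 hind]
    congr 1; ext1 i; exact (hid i).map_eq
  obtain ⟨B, hB, hPB, hBG⟩ := RobustCov.exists_measurableSet_of_map
    (aemeasurable_pi_lambda _ hXsm) hGm (by positivity : 0 ≤ 2 * ε) (by rw [hlaw]; exact hG)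
  refine ⟨B, hB, hPB, fun ω hω θ => ?_⟩
  rw [← hvar]
  exact hGb _ (hBG ω hω) θ
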